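/- Let $D=\{|z|<R\}$ with $R>0$, let $D^+=\{z\in D:\operatorname{Im}z>0\}$, and let $f(z,y)=q_k(z)y^k+\dots+q_1(z)y+q_0(z)$ be a polynomial of degree $k$ in $y$ whose coefficients $q_0,\dots,q_k$ are holomorphic in $D$, and which has no multiple factors as a polynomial in $y$ over the fraction field of $\mathcal O(D)$. Suppose that $\alpha_1,\dots,\alpha_k$ are single-valued holomorphic branches of its roots in $D^+$, that is, $f(z,y)=q_k(z)\prod_{\mu=1}^k(y-\alpha_\mu(z))$ for all $z\in D^+$. Let $A_\mu$ be a primitive of $\alpha_\mu$ in $D^+$ (for instance $A_\mu(z)=\int_p^z\alpha_\mu(w)\,dw$ with $p\in D^+$ fixed), and put $H_\mu=\operatorname{Re}A_\mu$. Fix $i\ne\nu$ in $\{1,\dots,k\}$, a real constant $c$, and $m,\ell\in\{1,\dots,k\}$. By a level curve $\Gamma$ of $H_i-H_\nu$ with level $c$ we mean a connected component of the smooth real analytic curve $$\{z\in D^+:\ H_i(z)-H_\nu(z)=c,\ \nabla(H_i-H_\nu)(z)\ne0\}$$ (the gradient condition, which is equivalent to $\alpha_i(z)\neq\alpha_\nu(z)$,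 holds automatically when the roots of $f(z,\cdot)$ are distinct for all $z\in D\setminus\{0\}$). Let $\partial_\Gamma$ denote the derivative along $\Gamma$ with respect to arc length, in the direction of the gradient $\nabla(H_i-H_\nu)$ rotated by $+\pi/2$. Then there exists $\delta>0$ such that for every such level curve $\Gamma$ with level $c$: either $\partial_\Gamma H_m-\partial_\Gamma H_\ell$ is identically zero on $\Gamma$, or it has no zero on $\Gamma\cap D(\delta)$, where $D(\delta)=\{|z|<\delta\}$. -/

import Mathlib

open Polynomial

noncomputable section

/-- The ring `𝒪(U)` of holomorphic functions on a set `U ⊆ ℂ` (used for `U` open). -/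
def holomorphicFunctions (U : Set ℂ) : Subring (U → ℂ) where
  carrier := {g | ∃ G : ℂ → ℂ, DifferentiableOn ℂ G U ∧ ∀ z : U, g z = G z}
  mul_mem' := by
    rintro a b ⟨A, hA, ha⟩ ⟨B, hB, hb⟩
    exact ⟨fun z => A z * B z, hA.mul hB, fun z => by simp [ha, hb]⟩
  one_mem' := ⟨fun _ => 1, differentiableOn_const _, fun _ => rfl⟩
  add_mem' := by
    rintro a b ⟨A, hA, ha⟩ ⟨B, hB, hb⟩
    exact ⟨fun z => A z + B z, hA.add hB, fun z => by simp [ha, hb]⟩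
  zero_mem' := ⟨fun _ => 0, differentiableOn_const _, fun _ => rfl⟩
  neg_mem' := by
    rintro a ⟨A, hA, ha⟩
    exact ⟨fun z => -A z, hA.neg, fun z => by simp [ha]⟩

/-- Evaluation of holomorphic functions at a point `z` of `U`. -/
def evalAt {U : Set ℂ} (z : U) : holomorphicFunctions U →+* ℂ :=
  (Pi.evalRingHom (fun _ : U => ℂ) z).comp (holomorphicFunctions U).subtype

/-- For `f ∈ 𝒪(U)[y]` and `z ∈ U`, the polynomial `f(z, y) ∈ ℂ[y]`. -/
def specializeAt {U : Set ℂ} (f : (holomorphicFunctions U)[X]) (z : U) : ℂ[X] :=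
  f.map (evalAt z)

/-- `f ∈ 𝒪(U)[y]` has no multiple factors, as a polynomial in `y` over the fraction field
of `𝒪(U)`. -/
def NoMultipleFactors {U : Set ℂ} (f : (holomorphicFunctions U)[X]) : Prop :=
  Squarefree (f.map (algebraMap (holomorphicFunctions U)
    (FractionRing (holomorphicFunctions U))))

/-- The upper half of the open disk of radius `R` centered at the origin. -/
def upperHalfDisk (R : ℝ) : Set ℂ := {z | z ∈ Metric.ball (0 : ℂ) R ∧ 0 < z.im}

/-- The smooth part of the level set `{F = c}` in `U`: the points where the gradient of `F`
does not vanish. -/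
def smoothLevelSet (U : Set ℂ) (F : ℂ → ℝ) (c : ℝ) : Set ℂ :=
  {z | z ∈ U ∧ F z = c ∧ gradient F z ≠ 0}

/-- `Γ` is a level curve of `F` in `U` with level `c`: a connected component of the smooth part
of the level set. -/
def IsLevelCurve (U : Set ℂ) (F : ℂ → ℝ) (c : ℝ) (Γ : Set ℂ) : Prop :=
  ∃ p ∈ smoothLevelSet U F c, Γ = connectedComponentIn (smoothLevelSet U F c) p

/-- The unit tangent vector at `z` to the level curve of `F` through `z`: the normalized gradient
of `F`, rotated by a right angle. -/
def unitTangent (F : ℂ → ℝ) (z : ℂ) : ℂ :=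
  Complex.I * gradient F z / (‖gradient F z‖ : ℂ)

/-- The derivative of `H` at `z` along the (oriented) level curve of `F` through `z`, with respect
to arc length. -/
def tangentialDeriv (F H : ℂ → ℝ) (z : ℂ) : ℝ :=
  fderiv ℝ H z (unitTangent F z)

end

/-! Write β = α_i − α_ν and B = A_i − A_ν. The unit tangent is i·conj(β)/|β|, so the difference of
tangential derivatives vanishes exactly where φ = (α_m − α_ℓ)/β is real. The smooth level set is
locally parametrised by Im B, and Im φ is real analytic in this parameter. Hence each zero of Im φ
on the level set is either isolated or interior to the zero set, and in the second case a clopen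
argument spreads the vanishing over the whole component. It remains to find one disk around 0
containing no isolated zero.

By Puiseux (`exists_puiseux`), the substitution z = t^N makes all the roots, hence φ, meromorphic in
t at 0. The roots form a finite covering of a punctured disk (`isCoveringMap_rootProj`). Pulled back
by exp, they become global and periodic, and a bound on the roots gives meromorphy. The half-disk
corresponds to the sector 0 < arg t < π/N.

The real locus of a meromorphic function is either a full punctured neighborhood or finitely many
analytic half-branches s ↦ τ(sζ) (`MeromorphicAt.exists_isBranchSystem`). Along a half-branch in the
sector, Re B has as derivative the real part of a meromorphic function of s, which has constant sign
for small s (`MeromorphicAt.re_eventually_sign`). If Re B is strictly monotone, it takes the value c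
at most once, and shrinking the disk discards that point. If it is constant and equal to c, the
branch runs inside the level set and its points are non-isolated zeros
(`eventually_frequently_on_branch`). The finitely many branches do not depend on Γ, so neither does
the radius. -/

/-! ### Local roots and root bounds for unramified families -/

/-- A family of complex polynomials over `U` of constant degree, with holomorphic coefficients and
without multiple roots. -/
structure IsUnramifiedFamily (U : Set ℂ) (k : ℕ) (p : ℂ → ℂ[X]) : Prop where
  coeff : ∀ j, DifferentiableOn ℂ (fun u => (p u).coeff j) U
  natDegree_eq : ∀ u ∈ U, (p u).natDegree = k
  separable : ∀ u ∈ U, (p u).Separable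

theorem ContinuousLinearMap.isInvertible_of_apply_one_ne_zero (L : ℂ →L[ℂ] ℂ) (h : L 1 ≠ 0) :
    L.IsInvertible := by
  refine ⟨ContinuousLinearEquiv.unitsEquivAut ℂ (Units.mk0 _ h), ?_⟩
  ext
  simp

namespace IsUnramifiedFamily

open Filter Topology

variable {U : Set ℂ} {k : ℕ} {p : ℂ → ℂ[X]}

theorem analyticAt_coeff (hp : IsUnramifiedFamily U k p) (hU : IsOpen U) {u : ℂ} (hu : u ∈ U)
    (j : ℕ) : AnalyticAt ℂ (fun u => (p u).coeff j) u :=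
  (hp.coeff j).analyticAt (hU.mem_nhds hu)

theorem eval_eq_sum (hp : IsUnramifiedFamily U k p) {u : ℂ} (hu : u ∈ U) (y : ℂ) :
    (p u).eval y = ∑ j ∈ Finset.range (k + 1), (p u).coeff j * y ^ j := by
  rw [eval_eq_sum_range, hp.natDegree_eq u hu]

theorem analyticAt_eval (hp : IsUnramifiedFamily U k p) (hU : IsOpen U) {v : ℂ × ℂ}
    (hv : v.1 ∈ U) : AnalyticAt ℂ (fun w : ℂ × ℂ => (p w.1).eval w.2) v := by
  have h : AnalyticAt ℂ (fun w : ℂ × ℂ =>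
      ∑ j ∈ Finset.range (k + 1), (p w.1).coeff j * w.2 ^ j) v := by
    refine Finset.analyticAt_fun_sum _ fun j _ => ?_
    exact (AnalyticAt.fun_comp (hp.analyticAt_coeff hU hv j) analyticAt_fst).mul
      (analyticAt_snd.pow j)
  refine h.congr ?_
  filter_upwards [continuousAt_fst.eventually_mem (hU.mem_nhds hv)] with w hw
  rw [hp.eval_eq_sum hw]

/-- Implicit function theorem for the roots of an unramified family. -/
theorem exists_local_root (hp : IsUnramifiedFamily U k p) (hU : IsOpen U) {v : ℂ × ℂ}
    (hv : v.1 ∈ U) (h0 : (p v.1).eval v.2 = 0) :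
    ∃ ψ : ℂ → ℂ, AnalyticAt ℂ ψ v.1 ∧ ψ v.1 = v.2 ∧
      ∀ᶠ w in 𝓝 v, (p w.1).eval w.2 = 0 ↔ ψ w.1 = w.2 := by
  have ha := hp.analyticAt_eval hU hv
  set f : ℂ × ℂ → ℂ := fun w => (p w.1).eval w.2 with hf
  have hc : ContDiffAt ℂ ⊤ f v := ha.contDiffAt
  -- The partial derivative in y is p'(y), nonzero at a root by separability.
  have hone : (fderiv ℂ f v ∘L .inr ℂ ℂ ℂ) 1 ≠ 0 := by
    have h1 : HasDerivAt (fun y : ℂ => f (v.1, y)) ((fderiv ℂ f v) (0, 1)) v.2 := by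
      have := ha.differentiableAt.hasFDerivAt
      exact HasFDerivAt.comp_hasDerivAt (f := fun y : ℂ => (v.1, y)) (x := v.2) this
        ((hasDerivAt_const _ _).prodMk (hasDerivAt_id _))
    have h2 : HasDerivAt (fun y : ℂ => f (v.1, y)) ((p v.1).derivative.eval v.2) v.2 :=
      (p v.1).hasDerivAt v.2
    have h3 : (fderiv ℂ f v ∘L .inr ℂ ℂ ℂ) 1 = (p v.1).derivative.eval v.2 := by
      simpa using h1.unique h2
    rw [h3]
    have := (hp.separable v.1 hv).eval₂_derivative_ne_zero (RingHom.id ℂ) (x := v.2)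
      (by simpa using h0)
    simpa using this
  have hinv := ContinuousLinearMap.isInvertible_of_apply_one_ne_zero _ hone
  refine ⟨hc.implicitFunction (by simp) hinv,
    (hc.contDiffAt_implicitFunction (by simp) hinv).analyticAt, 
    hc.implicitFunction_apply_self (by simp) hinv, ?_⟩
  have := hc.eventually_apply_eq_iff_implicitFunction (by simp) hinv
  simpa [hf, h0] using this

end IsUnramifiedFamily

/-- Solve q(y) = 0 for the top term and divide by a power of y when |y| ≥ 1. Keeping the leading
coefficient on the left keeps the bound useful near a zero of q_k, where roots may have poles. -/
theorem Polynomial.norm_leadingCoeff_mul_root_le (q : ℂ[X]) {y : ℂ} (hy : q.eval y = 0) :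
    ‖q.leadingCoeff * y‖ ≤ ∑ j ∈ Finset.range (q.natDegree + 1), ‖q.coeff j‖ := by
  rcases le_total ‖y‖ 1 with h1 | h1
  · calc ‖q.leadingCoeff * y‖ = ‖q.coeff q.natDegree‖ * ‖y‖ := by rw [norm_mul]; rfl
      _ ≤ ‖q.coeff q.natDegree‖ := mul_le_of_le_one_right (norm_nonneg _) h1
      _ ≤ _ := Finset.single_le_sum (f := fun j => ‖q.coeff j‖) (fun j _ => norm_nonneg _)
        (Finset.self_mem_range_succ _)
  · rcases Nat.eq_zero_or_eq_succ_pred q.natDegree with hn | hn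
    · have : q.leadingCoeff = 0 := by
        rw [eq_C_of_natDegree_eq_zero hn] at hy ⊢
        simpa using hy
      rw [this]
      simpa using Finset.sum_nonneg fun j _ => norm_nonneg (q.coeff j)
    · set n := q.natDegree.pred
      have hpos : 0 < ‖y‖ ^ n := pow_pos (one_pos.trans_le h1) _
      rw [eval_eq_sum_range, Finset.sum_range_succ, add_comm, add_eq_zero_iff_eq_neg] at hy
      have h2 : ‖q.leadingCoeff * y‖ * ‖y‖ ^ n
          = ‖∑ j ∈ Finset.range q.natDegree, q.coeff j * y ^ j‖ := by
        rw [← norm_neg (∑ j ∈ _, _), ← hy, ← norm_pow, ← norm_mul, mul_assoc, ← pow_succ',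
          ← Nat.succ_eq_add_one, ← hn]
        rfl
      have h3 : ‖∑ j ∈ Finset.range q.natDegree, q.coeff j * y ^ j‖
          ≤ (∑ j ∈ Finset.range q.natDegree, ‖q.coeff j‖) * ‖y‖ ^ n := by
        rw [Finset.sum_mul]
        refine (norm_sum_le _ _).trans (Finset.sum_le_sum fun j hj => ?_)
        rw [norm_mul, norm_pow]
        have : j ≤ n := by have := Finset.mem_range.1 hj; omega
        gcongr
      rw [← h2] at h3
      refine (le_of_mul_le_mul_right h3 hpos).trans ?_
      exact Finset.sum_le_sum_of_subset_of_nonneg (Finset.range_mono (Nat.le_succ _))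
        fun _ _ _ => norm_nonneg _

/-! ### The covering space of roots and its sections -/

namespace IsUnramifiedFamily

open Filter Topology

variable {U : Set ℂ} {k : ℕ} {p : ℂ → ℂ[X]}

/-- The Riemann surface of a family of polynomials over `U`. -/
def rootSurface (U : Set ℂ) (p : ℂ → ℂ[X]) : Set (ℂ × ℂ) :=
  {v | v.1 ∈ U ∧ (p v.1).eval v.2 = 0}

/-- The projection of the Riemann surface of a family of polynomials to the base. -/
def rootProj (U : Set ℂ) (p : ℂ → ℂ[X]) (e : rootSurface U p) : U := ⟨e.1.1, e.2.1⟩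

theorem continuous_rootProj : Continuous (rootProj U p) :=
  (continuous_fst.comp continuous_subtype_val).subtype_mk _

theorem norm_root_le (hp : IsUnramifiedFamily U k p) {v : ℂ × ℂ} (hv : v ∈ rootSurface U p)
    (h0 : (p v.1).coeff k ≠ 0) :
    ‖v.2‖ ≤ (∑ j ∈ Finset.range (k + 1), ‖(p v.1).coeff j‖) / ‖(p v.1).coeff k‖ := by
  rw [le_div_iff₀' (norm_pos_iff.2 h0), ← norm_mul]
  have := (p v.1).norm_leadingCoeff_mul_root_le hv.2
  rwa [leadingCoeff, hp.natDegree_eq _ hv.1] at this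

theorem coeff_ne_zero (hp : IsUnramifiedFamily U k p) {u : ℂ} (hu : u ∈ U) :
    (p u).coeff k ≠ 0 := by
  rw [← hp.natDegree_eq u hu]
  exact leadingCoeff_ne_zero.2 (hp.separable u hu).ne_zero

/-- The projection is proper: over a compact set the leading coefficient is bounded away from 0, so
the roots stay in a fixed closed ball. -/
theorem isClosedMap_rootProj (hp : IsUnramifiedFamily U k p) (hU : IsOpen U) :
    IsClosedMap (rootProj U p) := by
  refine IsProperMap.isClosedMap ?_
  have : LocallyCompactSpace U := hU.locallyCompactSpace
  rw [isProperMap_iff_isCompact_preimage]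
  refine ⟨continuous_rootProj, fun K hK => ?_⟩
  have hK' : IsCompact (Subtype.val '' K) := hK.image continuous_subtype_val
  have hKU : Subtype.val '' K ⊆ U := by rintro _ ⟨x, -, rfl⟩; exact x.2
  have hcont : ContinuousOn (fun u => (∑ j ∈ Finset.range (k + 1), ‖(p u).coeff j‖)
      / ‖(p u).coeff k‖) (Subtype.val '' K) := by
    refine ContinuousOn.mono ?_ hKU
    refine ContinuousOn.div ?_ (hp.coeff k).continuousOn.norm
      fun u hu => norm_ne_zero_iff.2 (hp.coeff_ne_zero hu)
    exact continuousOn_finsetSum _ fun j _ => (hp.coeff j).continuousOn.norm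
  obtain ⟨C, hC⟩ := hK'.bddAbove_image hcont
  have hcpt : IsCompact ((Subtype.val '' K) ×ˢ Metric.closedBall (0 : ℂ) C) :=
    hK'.prod (isCompact_closedBall _ _)
  rw [Topology.IsInducing.subtypeVal.isCompact_iff]
  have heq : Subtype.val '' (rootProj U p ⁻¹' K)
      = (Subtype.val '' K) ×ˢ Metric.closedBall (0 : ℂ) C ∩
        (fun w : ℂ × ℂ => (p w.1).eval w.2) ⁻¹' {0} := by
    ext v
    constructor
    · rintro ⟨e, he, rfl⟩
      have h1 : e.1.1 ∈ Subtype.val '' K := ⟨_, he, rfl⟩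
      refine ⟨⟨h1, ?_⟩, e.2.2⟩
      rw [mem_closedBall_zero_iff]
      exact (hp.norm_root_le e.2 (hp.coeff_ne_zero e.2.1)).trans (hC ⟨_, h1, rfl⟩)
    · rintro ⟨⟨⟨x, hx, hxv⟩, -⟩, h2⟩
      exact ⟨⟨v, hxv ▸ x.2, h2⟩, by simpa [rootProj, ← hxv] using hx, rfl⟩
  rw [heq]
  refine hcpt.of_isClosed_subset (ContinuousOn.preimage_isClosed_of_isClosed ?_ hcpt.isClosed
    isClosed_singleton) Set.inter_subset_left
  exact fun w hw => (hp.analyticAt_eval hU (hKU hw.1)).continuousAt.continuousWithinAt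

theorem isLocalHomeomorph_rootProj (hp : IsUnramifiedFamily U k p) (hU : IsOpen U) :
    IsLocalHomeomorph (rootProj U p) := by
  rw [isLocalHomeomorph_iff_isOpenEmbedding_restrict]
  intro e
  obtain ⟨ψ, -, -, hψ⟩ := hp.exists_local_root hU e.2.1 e.2.2
  obtain ⟨W, hW, hWo, heW⟩ := eventually_nhds_iff.1 hψ
  refine ⟨Subtype.val ⁻¹' W, (hWo.preimage continuous_subtype_val).mem_nhds heW, ?_⟩
  refine IsOpenEmbedding.of_continuous_injective_isOpenMap
    (continuous_rootProj.comp continuous_subtype_val) ?_ ?_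
  · rintro ⟨x, hx⟩ ⟨y, hy⟩ hxy
    have h1 : x.1.1 = y.1.1 := congrArg Subtype.val hxy
    have h2 := (hW _ hx).1 x.2.2
    have h3 := (hW _ hy).1 y.2.2
    exact Subtype.ext (Subtype.ext (Prod.ext h1 (by rw [← h2, ← h3, h1])))
  · refine IsOpenMap.comp (f := Subtype.val) (g := rootProj U p) ?_
      (hWo.preimage continuous_subtype_val).isOpenMap_subtype_val
    rw [isOpenMap_iff_nhds_le]
    intro x s hs
    obtain ⟨ψ, ha, h1, hψ⟩ := hp.exists_local_root hU x.2.1 x.2.2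
    have hs' : rootProj U p ⁻¹' s ∈ 𝓝 x := hs
    rw [nhds_subtype, mem_comap] at hs'
    obtain ⟨t, ht, hts⟩ := hs'
    have hcont : Tendsto (fun u => (u, ψ u)) (𝓝 x.1.1) (𝓝 x.1) := by
      have := (continuousAt_id (x := x.1.1)).prodMk ha.continuousAt
      rw [ContinuousAt, h1] at this
      exact this
    rw [nhds_subtype, mem_comap]
    refine ⟨_, hcont.eventually (Filter.Eventually.and ht hψ), fun u hu => ?_⟩
    exact hts (a := ⟨(u.1, ψ u.1), u.2, hu.2.2 rfl⟩) hu.1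

/-- A closed local homeomorphism with finite fibres is a covering. -/
theorem isCoveringMap_rootProj (hp : IsUnramifiedFamily U k p) (hU : IsOpen U) :
    IsCoveringMap (rootProj U p) := by
  rw [isCoveringMap_iff_isCoveringMapOn_univ]
  refine (hp.isClosedMap_rootProj hU).isCoveringMapOn_of_isLocalHomeomorphOn (fun u _ => ?_)
    (hp.isLocalHomeomorph_rootProj hU).isLocalHomeomorphOn
  refine Set.Finite.of_finite_image (f := fun e => e.1.2)
    (((p u).roots.toFinset).finite_toSet.subset ?_) ?_
  · rintro _ ⟨e, he, rfl⟩
    have h : e.1.1 = u := congrArg Subtype.val he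
    have := e.2.2
    rw [h] at this
    simpa [(hp.separable u u.2).ne_zero] using this
  · intro e he e' he' h
    have h1 : e.1.1 = u := congrArg Subtype.val he
    have h2 : e'.1.1 = u := congrArg Subtype.val he'
    exact Subtype.ext (Prod.ext (h1.trans h2.symm) h)

/-- Through every root passes a global holomorphic root, over a convex base. -/
theorem exists_root (hp : IsUnramifiedFamily U k p) (hU : IsOpen U) (hc : Convex ℝ U)
    {u₀ y₀ : ℂ} (hu₀ : u₀ ∈ U) (hy₀ : (p u₀).eval y₀ = 0) :
    ∃ a : ℂ → ℂ, a u₀ = y₀ ∧ ContinuousOn a U ∧ ∀ u ∈ U, (p u).eval (a u) = 0 := by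
  have := hc.contractibleSpace ⟨u₀, hu₀⟩
  have : LocallyPathConnectedSpace U := hU.locallyPathConnectedSpace
  -- A convex base is simply connected, so the identity lifts to a section of the covering.
  obtain ⟨F, ⟨hF0, hF⟩, -⟩ := (hp.isCoveringMap_rootProj hU).existsUnique_continuousMap_lifts
    (ContinuousMap.id U) ⟨u₀, hu₀⟩ ⟨(u₀, y₀), hu₀, hy₀⟩ rfl
  classical
  have hF' : ∀ u : U, (F u).1.1 = u := fun u => congrArg Subtype.val (congrFun hF u)
  refine ⟨fun u => if h : u ∈ U then (F ⟨u, h⟩).1.2 else 0, by simp [hu₀, hF0], ?_, ?_⟩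
  · rw [continuousOn_iff_continuous_domRestrict]
    have : Continuous fun u : U => (F u).1.2 := by fun_prop
    convert this using 2 with u
    simp
  · intro u hu
    have h := (F ⟨u, hu⟩).2.2
    rw [hF' ⟨u, hu⟩] at h
    simpa [hu] using h

/-- Continuous roots over a connected set are determined by their value at one point. -/
theorem root_eqOn (hp : IsUnramifiedFamily U k p) (hU : IsOpen U) {S : Set ℂ} (hSU : S ⊆ U)
    (hS : IsPreconnected S) {a b : ℂ → ℂ} (ha : ContinuousOn a S) (hb : ContinuousOn b S)
    (ha0 : ∀ u ∈ S, (p u).eval (a u) = 0) (hb0 : ∀ u ∈ S, (p u).eval (b u) = 0)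
    {u₀ : ℂ} (hu₀ : u₀ ∈ S) (h : a u₀ = b u₀) : Set.EqOn a b S := by
  have := Subtype.preconnectedSpace hS
  have key := (hp.isCoveringMap_rootProj hU).eq_of_comp_eq (A := S)
    (g₁ := fun u => ⟨(u, a u), hSU u.2, ha0 u u.2⟩) (g₂ := fun u => ⟨(u, b u), hSU u.2, hb0 u u.2⟩)
    (((continuous_subtype_val.prodMk ha.domRestrict)).subtype_mk _)
    (((continuous_subtype_val.prodMk hb.domRestrict)).subtype_mk _) rfl ⟨u₀, hu₀⟩
    (Subtype.ext (Prod.ext rfl h))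
  intro u hu
  exact congrArg (fun e => e.1.2) (congrFun key ⟨u, hu⟩)

/-- Continuous roots are holomorphic. -/
theorem differentiableOn_root (hp : IsUnramifiedFamily U k p) (hU : IsOpen U) {a : ℂ → ℂ}
    (ha : ContinuousOn a U) (ha0 : ∀ u ∈ U, (p u).eval (a u) = 0) : DifferentiableOn ℂ a U := by
  intro u hu
  obtain ⟨ψ, hψa, -, hψ⟩ := hp.exists_local_root hU (v := (u, a u)) hu (ha0 u hu)
  have hcont : Tendsto (fun w => (w, a w)) (𝓝 u) (𝓝 (u, a u)) :=
    (continuousAt_id (x := u)).prodMk (ha.continuousAt (hU.mem_nhds hu))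
  refine (hψa.differentiableAt.congr_of_eventuallyEq ?_).differentiableWithinAt
  filter_upwards [hcont.eventually hψ, hU.mem_nhds hu] with w hw hwU
  exact (hw.1 (ha0 w hwU)).symm

end IsUnramifiedFamily

/-! ### Signs and real loci of meromorphic germs -/

open Filter Topology

/-- The real part of a meromorphic function has a constant sign on the positive half-line
near the origin. -/
theorem MeromorphicAt.re_eventually_sign {h : ℂ → ℂ} (hh : MeromorphicAt h 0) :
    (∀ᶠ s : ℝ in 𝓝[>] 0, 0 < (h s).re) ∨ (∀ᶠ s : ℝ in 𝓝[>] 0, (h s).re = 0) ∨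
      (∀ᶠ s : ℝ in 𝓝[>] 0, (h s).re < 0) := by
  obtain ⟨n, hn⟩ := hh
  -- For s > 0 the factor s^n clears the pole without changing the sign of the real part.
  set r : ℝ → ℝ := fun s => (((s : ℂ) - 0) ^ n • h s).re with hr
  have hra : AnalyticAt ℝ r 0 := by
    have h1 : AnalyticAt ℝ (fun z : ℂ => (z - 0) ^ n • h z) ((0 : ℝ) : ℂ) := by
      simpa using hn.restrictScalars (𝕜 := ℝ)
    have h2 : AnalyticAt ℝ (fun s : ℝ => (s : ℂ)) 0 := Complex.ofRealCLM.analyticAt 0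
    exact (Complex.reCLM.analyticAt _).comp (AnalyticAt.fun_comp h1 h2)
  have hrs : ∀ s : ℝ, r s = s ^ n * (h s).re := fun s => by
    simp only [hr, sub_zero, smul_eq_mul]
    rw [← Complex.ofReal_pow, Complex.re_ofReal_mul]
  have hpos : ∀ᶠ s : ℝ in 𝓝[>] 0, 0 < s := eventually_mem_nhdsWithin
  by_cases hz : ∀ᶠ s in 𝓝 0, r s = 0
  · refine Or.inr (Or.inl ?_)
    filter_upwards [hpos, hz.filter_mono nhdsWithin_le_nhds] with s hs h0
    rw [hrs] at h0
    exact (mul_eq_zero.1 h0).resolve_left (pow_pos hs _).ne'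
  · obtain ⟨k, g, hg, hg0, hgr⟩ := hra.exists_eventuallyEq_pow_smul_nonzero_iff.2 hz
    have hgr' : ∀ᶠ s : ℝ in 𝓝[>] 0, s ^ n * (h s).re = s ^ k * g s := by
      filter_upwards [hgr.filter_mono nhdsWithin_le_nhds] with s hs
      rw [← hrs, hs, sub_zero, smul_eq_mul]
    rcases hg0.lt_or_gt with hg0 | hg0
    · refine Or.inr (Or.inr ?_)
      have : ∀ᶠ s in 𝓝 0, g s < 0 := hg.continuousAt.eventually_lt_const hg0
      filter_upwards [hpos, hgr', this.filter_mono nhdsWithin_le_nhds] with s hs h1 h2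
      by_contra! hcon
      have h3 := mul_nonneg (pow_pos hs n).le hcon
      have h4 := mul_neg_of_pos_of_neg (pow_pos hs k) h2
      linarith
    · refine Or.inl ?_
      have : ∀ᶠ s in 𝓝 0, 0 < g s := hg.continuousAt.eventually_const_lt hg0
      filter_upwards [hpos, hgr', this.filter_mono nhdsWithin_le_nhds] with s hs h1 h2
      by_contra! hcon
      have h3 := mul_nonpos_of_nonneg_of_nonpos (pow_pos hs n).le hcon
      have h4 := mul_pos (pow_pos hs k) h2
      linarith

/-- An analytic function with a nonzero value is locally an `m`-th power. -/
theorem AnalyticAt.exists_analyticAt_pow_eq {g : ℂ → ℂ} (hg : AnalyticAt ℂ g 0) (h0 : g 0 ≠ 0)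
    {m : ℕ} (hm : m ≠ 0) : ∃ v : ℂ → ℂ, AnalyticAt ℂ v 0 ∧ v 0 ≠ 0 ∧ ∀ᶠ t in 𝓝 0, v t ^ m = g t := by
  have hm' : (m : ℂ) ≠ 0 := Nat.cast_ne_zero.2 hm
  -- Dividing by g 0 moves the values near 1, away from the cut of the logarithm.
  have hslit : g 0 / g 0 ∈ Complex.slitPlane := by rw [div_self h0]; exact Complex.one_mem_slitPlane
  have hq : AnalyticAt ℂ (fun t => g t / g 0) 0 := hg.div_const
  refine ⟨fun t => Complex.exp ((Complex.log (g 0) + Complex.log (g t / g 0)) / m), ?_,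
    Complex.exp_ne_zero _, ?_⟩
  · exact ((analyticAt_const.add (hq.clog hslit)).div_const).cexp
  · filter_upwards [hg.continuousAt.eventually_ne h0] with t ht
    rw [← Complex.exp_nat_mul, mul_div_cancel₀ _ hm', Complex.exp_add, Complex.exp_log h0,
      Complex.exp_log (div_ne_zero ht h0), mul_div_cancel₀ _ h0]

/-- `IsBranchSystem Z τ Q` : near the origin, the set defined by `Q` consists of the finitely many
analytic half-branches `s ↦ τ (s ζ)`, `s > 0`, `ζ ∈ Z`. -/
structure IsBranchSystem (Z : Finset ℂ) (τ : ℂ → ℂ) (Q : ℂ → Prop) : Prop where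
  analyticAt : AnalyticAt ℂ τ 0
  map_zero : τ 0 = 0
  deriv_ne_zero : deriv τ 0 ≠ 0
  ne_zero : ∀ ζ ∈ Z, ζ ≠ 0
  mem : ∀ ζ ∈ Z, ∀ᶠ s : ℝ in 𝓝[>] 0, Q (τ (s * ζ))
  of_forall_mem : ∀ P : ℂ → Prop, (∀ ζ ∈ Z, ∀ᶠ s : ℝ in 𝓝[>] 0, P (τ (s * ζ))) →
    ∀ᶠ t in 𝓝[≠] 0, Q t → P t

theorem IsBranchSystem.tendsto {τ : ℂ → ℂ} (ha : AnalyticAt ℂ τ 0) (h0 : τ 0 = 0)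
    (h1 : deriv τ 0 ≠ 0) {ζ : ℂ} (hζ : ζ ≠ 0) :
    Tendsto (fun s : ℝ => τ (s * ζ)) (𝓝[>] 0) (𝓝[≠] 0) := by
  have hτ : Tendsto τ (𝓝[≠] 0) (𝓝[≠] 0) := by
    have := ha.differentiableAt.hasDerivAt.tendsto_nhdsNE h1
    rwa [h0] at this
  refine hτ.comp ?_
  rw [tendsto_nhdsWithin_iff]
  refine ⟨?_, ?_⟩
  · have : Continuous fun s : ℝ => (s : ℂ) * ζ := by fun_prop
    exact (this.tendsto' 0 0 (by simp)).mono_left nhdsWithin_le_nhds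
  · filter_upwards [self_mem_nhdsWithin] with s hs
    exact mul_ne_zero (Complex.ofReal_ne_zero.2 (ne_of_gt hs)) hζ

theorem IsBranchSystem.congr {Z : Finset ℂ} {τ : ℂ → ℂ} {Q Q' : ℂ → Prop}
    (h : IsBranchSystem Z τ Q) (hQ : ∀ᶠ t in 𝓝[≠] 0, Q t ↔ Q' t) : IsBranchSystem Z τ Q' where
  analyticAt := h.analyticAt
  map_zero := h.map_zero
  deriv_ne_zero := h.deriv_ne_zero
  ne_zero := h.ne_zero
  mem ζ hζ := by
    filter_upwards [h.mem ζ hζ, (IsBranchSystem.tendsto h.analyticAt h.map_zero h.deriv_ne_zero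
      (h.ne_zero ζ hζ)).eventually hQ] with s h1 h2
    exact h2.1 h1
  of_forall_mem P hP := by
    filter_upwards [h.of_forall_mem P hP, hQ] with t h1 h2 h3
    exact h1 (h2.2 h3)

theorem isBranchSystem_empty {Q : ℂ → Prop} (h : ∀ᶠ t in 𝓝[≠] 0, ¬ Q t) :
    IsBranchSystem ∅ id Q where
  analyticAt := analyticAt_id
  map_zero := rfl
  deriv_ne_zero := by simp
  ne_zero := by simp
  mem := by simp
  of_forall_mem P _ := by filter_upwards [h] with t h1 h2 using (h1 h2).elim

/-- With v^m = g, the function w = t·v is a local coordinate and t^m g = w^m. This is real exactly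
on the rays through the 2m-th roots of unity, and τ is the inverse of w. -/
theorem isBranchSystem_im_pow {m : ℕ} (hm : m ≠ 0) {g : ℂ → ℂ} (hg : AnalyticAt ℂ g 0)
    (h0 : g 0 ≠ 0) : ∃ Z τ, IsBranchSystem Z τ fun t => (t ^ m * g t).im = 0 := by
  obtain ⟨v, hv, hv0, hvm⟩ := hg.exists_analyticAt_pow_eq h0 hm
  set w : ℂ → ℂ := fun t => t * v t with hw
  have hwa : AnalyticAt ℂ w 0 := analyticAt_id.mul hv
  have hw0 : w 0 = 0 := by simp [hw]
  have hwd : HasDerivAt w (v 0) 0 := by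
    have := (hasDerivAt_id (0 : ℂ)).mul hv.differentiableAt.hasDerivAt
    simp only [id, one_mul, zero_mul, add_zero] at this
    exact this
  have hwd0 : deriv w 0 ≠ 0 := by rw [hwd.deriv]; exact hv0
  set τ := hwa.hasStrictDerivAt.localInverse w _ _ hwd0 with hτ
  have hτa : AnalyticAt ℂ τ 0 := by simpa [hw0] using hwa.analyticAt_localInverse hwd0
  have hτw : ∀ᶠ t in 𝓝 0, τ (w t) = t :=
    HasStrictDerivAt.eventually_left_inverse hwa.hasStrictDerivAt hwd0
  have hwτ : ∀ᶠ x in 𝓝 0, w (τ x) = x := by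
    have := HasStrictDerivAt.eventually_right_inverse hwa.hasStrictDerivAt hwd0
    rwa [hw0] at this
  have hτ0 : τ 0 = 0 := by simpa [hw0] using hτw.self_of_nhds
  have hτd : deriv τ 0 ≠ 0 := by
    have h1 := HasStrictDerivAt.to_localInverse hwa.hasStrictDerivAt hwd0
    rw [hw0] at h1
    rw [h1.hasDerivAt.deriv]
    exact inv_ne_zero hwd0
  have hwpow : ∀ᶠ t in 𝓝 0, w t ^ m = t ^ m * g t := by
    filter_upwards [hvm] with t ht
    rw [hw, mul_pow, ht]
  have hZ : ∀ ζ ∈ (nthRoots (2 * m) (1 : ℂ)).toFinset, ζ ^ m = 1 ∨ ζ ^ m = -1 := by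
    intro ζ hζ
    rw [Multiset.mem_toFinset, mem_nthRoots (by omega), mul_comm, pow_mul] at hζ
    simpa using hζ
  refine ⟨(nthRoots (2 * m) (1 : ℂ)).toFinset, τ, hτa, hτ0, hτd, ?_, ?_, ?_⟩
  · rintro ζ hζ rfl
    rcases hZ 0 hζ with h | h <;> simp [hm] at h
  · intro ζ hζ
    have hζ0 : ζ ≠ 0 := by
      rintro rfl
      rcases hZ 0 hζ with h | h <;> simp [hm] at h
    have htend := (IsBranchSystem.tendsto hτa hτ0 hτd hζ0).mono_right nhdsWithin_le_nhds
    have htend' := (IsBranchSystem.tendsto analyticAt_id rfl (by simp) hζ0).mono_right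
      nhdsWithin_le_nhds
    filter_upwards [htend.eventually hwpow, htend'.eventually hwτ] with s h1 h2
    simp only [id] at h2
    rw [← h1, h2, mul_pow, ← Complex.ofReal_pow, Complex.im_ofReal_mul]
    rcases hZ ζ hζ with h | h <;> simp [h]
  · intro P hP
    have hP' : ∀ᶠ s : ℝ in 𝓝[>] 0, ∀ ζ ∈ (nthRoots (2 * m) (1 : ℂ)).toFinset, P (τ (s * ζ)) :=
      (eventually_all_finset _).2 hP
    have hnorm : Tendsto (fun t => ‖w t‖) (𝓝[≠] 0) (𝓝[>] 0) := by
      have h1 : Tendsto w (𝓝[≠] 0) (𝓝[≠] 0) := by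
        have := hwd.tendsto_nhdsNE hv0
        rwa [hw0] at this
      exact tendsto_norm_nhdsNE_zero.comp h1
    filter_upwards [hnorm.eventually hP', hτw.filter_mono nhdsWithin_le_nhds,
      hwpow.filter_mono nhdsWithin_le_nhds, hnorm.eventually eventually_mem_nhdsWithin]
      with t h1 h2 h3 h4 h5
    have hne : ‖w t‖ ≠ 0 := ne_of_gt h4
    have hne' : (‖w t‖ : ℂ) ≠ 0 := Complex.ofReal_ne_zero.2 hne
    -- The point t lies on the branch of direction ζ = w/|w| at parameter s = |w|.
    have key := h1 (w t / ‖w t‖) ?_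
    · rwa [mul_div_cancel₀ _ hne', h2] at key
    · rw [Multiset.mem_toFinset, mem_nthRoots (by omega), mul_comm, pow_mul, div_pow, h3]
      set x := t ^ m * g t
      have hx : x = (x.re : ℂ) := Complex.ext rfl (by simpa using h5)
      have hxn : ‖w t‖ ^ m = |x.re| := by rw [← norm_pow, h3, hx, Complex.norm_real]; rfl
      rw [← Complex.ofReal_pow, hxn, hx, div_pow]
      have hx0 : x.re ≠ 0 := by
        intro h
        rw [h, abs_zero] at hxn
        exact hne (pow_eq_zero_iff hm |>.1 hxn)
      norm_cast
      rw [sq_abs, div_self (pow_ne_zero _ hx0)]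

theorem AnalyticAt.exists_isBranchSystem {ψ : ℂ → ℂ} (hψ : AnalyticAt ℂ ψ 0) :
    (∀ᶠ t in 𝓝[≠] 0, (ψ t).im = 0) ∨ ∃ Z τ, IsBranchSystem Z τ fun t => (ψ t).im = 0 := by
  by_cases him : (ψ 0).im = 0
  swap
  · right
    have : ∀ᶠ t in 𝓝 0, (ψ t).im ≠ 0 :=
      (Complex.continuous_im.continuousAt.comp hψ.continuousAt).eventually_ne him
    exact ⟨∅, id, isBranchSystem_empty (this.filter_mono nhdsWithin_le_nhds)⟩
  have hsub : AnalyticAt ℂ (fun t => ψ t - ψ 0) 0 := hψ.sub analyticAt_const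
  by_cases hz : ∀ᶠ t in 𝓝 0, ψ t - ψ 0 = 0
  · left
    filter_upwards [hz.filter_mono nhdsWithin_le_nhds] with t ht
    rw [sub_eq_zero.1 ht, him]
  · right
    obtain ⟨m, g, hg, hg0, hgm⟩ := hsub.exists_eventuallyEq_pow_smul_nonzero_iff.2 hz
    have hm : m ≠ 0 := by
      rintro rfl
      have := hgm.self_of_nhds
      simp only [sub_self, pow_zero, one_smul] at this
      exact hg0 this.symm
    obtain ⟨Z, τ, h⟩ := isBranchSystem_im_pow hm hg hg0
    refine ⟨Z, τ, h.congr ?_⟩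
    filter_upwards [hgm.filter_mono nhdsWithin_le_nhds] with t ht
    rw [sub_zero, smul_eq_mul] at ht
    rw [← ht, Complex.sub_im, him, sub_zero]

/-- Near a point, the set where a meromorphic function is real consists of finitely many analytic
half-branches, unless it is a full punctured neighborhood. -/
theorem MeromorphicAt.exists_isBranchSystem {φ : ℂ → ℂ} (hφ : MeromorphicAt φ 0) :
    (∀ᶠ t in 𝓝[≠] 0, (φ t).im = 0) ∨ ∃ Z τ, IsBranchSystem Z τ fun t => (φ t).im = 0 := by
  by_cases htop : meromorphicOrderAt φ 0 = ⊤
  · left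
    filter_upwards [meromorphicOrderAt_eq_top_iff.1 htop] with t ht
    rw [ht, Complex.zero_im]
  obtain ⟨g, hg, hg0, hgn⟩ := (meromorphicOrderAt_ne_top_iff hφ).1 htop
  -- Inversion preserves realness, so a pole can be traded for a zero.
  have hinv : ∀ z : ℂ, (z⁻¹).im = 0 ↔ z.im = 0 := fun z => by
    by_cases hz : z = 0
    · simp [hz]
    · simp [Complex.inv_im, hz]
  have key : ∃ ψ : ℂ → ℂ, AnalyticAt ℂ ψ 0 ∧ ∀ᶠ t in 𝓝[≠] 0, (ψ t).im = 0 ↔ (φ t).im = 0 := by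
    obtain ⟨n, hn | hn⟩ := Int.eq_nat_or_neg (meromorphicOrderAt φ 0).untop₀
    · refine ⟨fun t => t ^ n * g t, (analyticAt_id.pow n).mul hg, ?_⟩
      filter_upwards [hgn] with t ht
      rw [ht, hn, sub_zero, zpow_natCast, smul_eq_mul]
    · refine ⟨fun t => t ^ n * (g t)⁻¹, (analyticAt_id.pow n).mul (hg.inv hg0), ?_⟩
      filter_upwards [hgn] with t ht
      rw [ht, hn, sub_zero, zpow_neg, zpow_natCast, smul_eq_mul, ← hinv, mul_inv, inv_inv]
  obtain ⟨ψ, hψ, hψφ⟩ := key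
  rcases hψ.exists_isBranchSystem with h | ⟨Z, τ, h⟩
  · left
    filter_upwards [h, hψφ] with t h1 h2
    exact h2.1 h1
  · exact Or.inr ⟨Z, τ, h.congr hψφ⟩

/-! ### Zeros along a level curve and their propagation -/

/-- Along a smooth level curve of `re B`, the imaginary part of a holomorphic function either
vanishes identically near a given point or has an isolated zero there, if any. -/
theorem AnalyticAt.im_eq_zero_or_ne_zero_on_level {B φ : ℂ → ℂ} {p : ℂ} (hB : AnalyticAt ℂ B p)
    (hB' : deriv B p ≠ 0) (hφ : AnalyticAt ℂ φ p) {M : Set ℂ} {c : ℝ} (hM : ∀ z ∈ M, (B z).re = c)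
    (hp : p ∈ M) : (∀ᶠ z in 𝓝[M] p, (φ z).im = 0) ∨ ∀ᶠ z in 𝓝[M \ {p}] p, (φ z).im ≠ 0 := by
  set b := hB.hasStrictDerivAt.localInverse B _ _ hB' with hb
  have hba : AnalyticAt ℂ b (B p) := hB.analyticAt_localInverse hB'
  have hbB : ∀ᶠ z in 𝓝 p, b (B z) = z :=
    HasStrictDerivAt.eventually_left_inverse hB.hasStrictDerivAt hB'
  have hrepr : ∀ z ∈ M, B z = c + ((B z).im : ℂ) * Complex.I := fun z hz => by
    conv_lhs => rw [← Complex.re_add_im (B z), hM z hz]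
  -- B straightens the level set to the line Re = c, so y = Im B is an analytic parameter and
  -- one-variable isolation of zeros applies.
  set g : ℝ → ℝ := fun y => (φ (b (c + (y : ℂ) * Complex.I))).im with hg
  have hga : AnalyticAt ℝ g (B p).im := by
    have h1 : AnalyticAt ℂ (fun x => φ (b x)) (B p) := by
      refine AnalyticAt.fun_comp ?_ hba
      rwa [hbB.self_of_nhds]
    have h2 : AnalyticAt ℝ (fun y : ℝ => (c : ℂ) + (y : ℂ) * Complex.I) (B p).im :=
      analyticAt_const.add ((Complex.ofRealCLM.analyticAt _).mul analyticAt_const)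
    have h3 : AnalyticAt ℝ (fun x => φ (b x)) ((c : ℂ) + ((B p).im : ℂ) * Complex.I) := by
      rw [← hrepr p hp]
      exact h1.restrictScalars
    exact (Complex.imCLM.analyticAt _).comp (AnalyticAt.fun_comp (g := fun x => φ (b x)) h3 h2)
  have hgz : ∀ᶠ z in 𝓝[M] p, g (B z).im = (φ z).im := by
    filter_upwards [self_mem_nhdsWithin, hbB.filter_mono nhdsWithin_le_nhds] with z hz h
    simp only [hg]
    rw [← hrepr z hz, h]
  have htend : Tendsto (fun z => (B z).im) (𝓝 p) (𝓝 (B p).im) :=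
    Complex.continuous_im.continuousAt.comp hB.continuousAt
  rcases hga.eventually_eq_zero_or_eventually_ne_zero with h | h
  · left
    filter_upwards [(htend.eventually h).filter_mono nhdsWithin_le_nhds, hgz] with z h1 h2
    rw [← h2, h1]
  · right
    rw [eventually_nhdsWithin_iff] at h
    filter_upwards [(htend.eventually h).filter_mono nhdsWithin_le_nhds,
      hgz.filter_mono (nhdsWithin_mono _ Set.sdiff_subset), self_mem_nhdsWithin,
      hbB.filter_mono nhdsWithin_le_nhds] with z h1 h2 h3 h4
    rw [← h2]
    refine h1 fun heq => h3.2 ?_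
    rw [Set.mem_singleton_iff] at heq
    rw [Set.mem_singleton_iff, ← h4, hrepr z h3.1, heq, ← hrepr p hp, hbB.self_of_nhds]

/-- If, around each point of `M`, a function vanishes identically on `M` or has no zero other than
that point, then it vanishes on the component of any point of `M` around which it vanishes. -/
theorem eq_zero_on_connectedComponentIn {X : Type*} [TopologicalSpace X] [T1Space X] {M : Set X}
    {Q : X → ℝ} (h : ∀ p ∈ M, (∀ᶠ z in 𝓝[M] p, Q z = 0) ∨ ∀ᶠ z in 𝓝[M \ {p}] p, Q z ≠ 0)
    {q p : X} (hq : q ∈ connectedComponentIn M p) (hq0 : ∀ᶠ z in 𝓝[M] q, Q z = 0) :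
    ∀ z ∈ connectedComponentIn M p, Q z = 0 := by
  set Γ := connectedComponentIn M p
  have hΓM : Γ ⊆ M := connectedComponentIn_subset M p
  have := Subtype.preconnectedSpace (isPreconnected_connectedComponentIn (F := M) (x := p))
  set W : Set Γ := {x | ∀ᶠ w in 𝓝[M] (x : X), Q w = 0} with hW
  have htend : ∀ x : Γ, Tendsto ((↑) : Γ → X) (𝓝 x) (𝓝[M] x) := fun x =>
    tendsto_nhdsWithin_iff.2 ⟨continuous_subtype_val.continuousAt,
      Eventually.of_forall fun y => hΓM y.2⟩
  have hopen : IsOpen W := by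
    rw [isOpen_iff_mem_nhds]
    exact fun x hx => (htend x).eventually (eventually_eventually_nhdsWithin.2 hx)
  have hclosed : IsClosed W := by
    rw [← isOpen_compl_iff, isOpen_iff_mem_nhds]
    intro x hx
    have hne := (h x (hΓM x.2)).resolve_left hx
    rw [eventually_nhdsWithin_iff] at hne
    filter_upwards [continuous_subtype_val.continuousAt.eventually hne] with z hz hzW
    by_cases hzx : z = x
    · exact hx (hzx ▸ hzW)
    · exact hz ⟨hΓM z.2, fun hcon => hzx (Subtype.ext hcon)⟩
        ((hzW : ∀ᶠ w in 𝓝[M] (z : X), Q w = 0).self_of_nhdsWithin (hΓM z.2))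
  have huniv : W = Set.univ := IsClopen.eq_univ ⟨hclosed, hopen⟩ ⟨⟨q, hq⟩, hq0⟩
  intro z hz
  have hzW : (⟨z, hz⟩ : Γ) ∈ W := huniv ▸ Set.mem_univ _
  exact (hzW : ∀ᶠ w in 𝓝[M] z, Q w = 0).self_of_nhdsWithin (hΓM hz)

/-! ### The ring of holomorphic functions and specialization of f -/

section HolomorphicFunctions

variable {U : Set ℂ}

/-- The extension by zero of a holomorphic function on `U`. -/
noncomputable def zeroExtend (g : holomorphicFunctions U) (z : ℂ) : ℂ :=
  open Classical in if h : z ∈ U then evalAt ⟨z, h⟩ g else 0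

theorem zeroExtend_of_mem (g : holomorphicFunctions U) {z : ℂ} (h : z ∈ U) :
    zeroExtend g z = evalAt ⟨z, h⟩ g := dif_pos h

theorem differentiableOn_zeroExtend (g : holomorphicFunctions U) :
    DifferentiableOn ℂ (zeroExtend g) U := by
  obtain ⟨G, hG, hg⟩ := g.2
  refine hG.congr fun z hz => ?_
  rw [zeroExtend_of_mem g hz]
  exact hg ⟨z, hz⟩

theorem eq_zero_of_zeroExtend {g : holomorphicFunctions U} (h : ∀ z ∈ U, zeroExtend g z = 0) :
    g = 0 := by
  refine Subtype.ext (funext fun z => ?_)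
  have := h z z.2
  rwa [zeroExtend_of_mem g z.2] at this

theorem isDomain_holomorphicFunctions (hU : IsOpen U) (hc : IsPreconnected U) (hne : U.Nonempty) :
    IsDomain (holomorphicFunctions U) := by
  have : Nontrivial (holomorphicFunctions U) := by
    obtain ⟨z, hz⟩ := hne
    exact (evalAt (U := U) ⟨z, hz⟩).domain_nontrivial
  have : NoZeroDivisors (holomorphicFunctions U) := by
    refine ⟨fun {a b} hab => ?_⟩
    have h : ∀ z ∈ U, zeroExtend a z * zeroExtend b z = 0 := fun z hz => by
      rw [zeroExtend_of_mem a hz, zeroExtend_of_mem b hz, ← map_mul, hab, map_zero]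
    rcases ((differentiableOn_zeroExtend a).analyticOnNhd hU).eq_zero_or_eq_zero_of_mul_eq_zero
      ((differentiableOn_zeroExtend b).analyticOnNhd hU) h hc with h | h
    · exact Or.inl (eq_zero_of_zeroExtend h)
    · exact Or.inr (eq_zero_of_zeroExtend h)
  exact NoZeroDivisors.to_isDomain _

theorem eventually_zeroExtend_ne_zero (hU : IsOpen U) (hc : IsPreconnected U)
    {g : holomorphicFunctions U} (hg : g ≠ 0) {z₀ : ℂ} (hz₀ : z₀ ∈ U) :
    ∀ᶠ z in 𝓝[≠] z₀, zeroExtend g z ≠ 0 := by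
  by_contra hcon
  refine hg (eq_zero_of_zeroExtend ?_)
  have ha := (differentiableOn_zeroExtend g).analyticOnNhd hU
  exact ha.eqOn_zero_of_preconnected_of_frequently_eq_zero hc hz₀ (hcon ∘ fun h => h)

end HolomorphicFunctions

/-- A Bézout identity without denominators for squarefree polynomials. -/
theorem exists_bezout_derivative_of_squarefree {R : Type*} [CommRing R] [IsDomain R] [CharZero R]
    {f : R[X]} (hf : Squarefree (f.map (algebraMap R (FractionRing R)))) :
    ∃ (a b : R[X]) (d : R), d ≠ 0 ∧ a * f + b * derivative f = C d := by
  have hsep := PerfectField.separable_iff_squarefree.2 hf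
  obtain ⟨a, b, hab⟩ := hsep
  obtain ⟨da, hda0, hda⟩ := IsLocalization.integerNormalization_spec (nonZeroDivisors R) a
  obtain ⟨db, hdb0, hdb⟩ := IsLocalization.integerNormalization_spec (nonZeroDivisors R) b
  set a' := IsLocalization.integerNormalization (nonZeroDivisors R) a
  set b' := IsLocalization.integerNormalization (nonZeroDivisors R) b
  refine ⟨C db * a', C da * b', da * db,
    mul_ne_zero (nonZeroDivisors.ne_zero hda0) (nonZeroDivisors.ne_zero hdb0), ?_⟩
  apply Polynomial.map_injective _ (IsFractionRing.injective R (FractionRing R))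
  have e1 : (da • a : (FractionRing R)[X]) = C (algebraMap R (FractionRing R) da) * a := by
    rw [← smul_eq_C_mul, algebraMap_smul]
  have e2 : (db • b : (FractionRing R)[X]) = C (algebraMap R (FractionRing R) db) * b := by
    rw [← smul_eq_C_mul, algebraMap_smul]
  simp only [Polynomial.map_add, Polynomial.map_mul, map_C, hda, hdb, e1, e2, map_mul]
  rw [derivative_map] at hab
  linear_combination
    C (algebraMap R (FractionRing R) da) * C (algebraMap R (FractionRing R) db) * hab

section Specialize

variable {U : Set ℂ}

/-- The polynomial `f(z, y)`, as a function of `z ∈ ℂ`, equal to zero outside of `U`. -/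
noncomputable def specializeExtend (f : (holomorphicFunctions U)[X]) (z : ℂ) : ℂ[X] :=
  open Classical in if h : z ∈ U then specializeAt f ⟨z, h⟩ else 0

theorem specializeExtend_of_mem (f : (holomorphicFunctions U)[X]) {z : ℂ} (h : z ∈ U) :
    specializeExtend f z = specializeAt f ⟨z, h⟩ := dif_pos h

theorem coeff_specializeExtend (f : (holomorphicFunctions U)[X]) (z : ℂ) (j : ℕ) :
    (specializeExtend f z).coeff j = zeroExtend (f.coeff j) z := by
  by_cases h : z ∈ U
  · rw [specializeExtend_of_mem f h, zeroExtend_of_mem _ h, specializeAt, coeff_map]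
  · simp [specializeExtend, zeroExtend, h]

/-- The denominator-free Bézout identity specializes to one for f(z, ·) wherever d(z) ≠ 0, and the
zeros of d are isolated. -/
theorem eventually_separable_specializeExtend (hU : IsOpen U) (hc : IsPreconnected U)
    {f : (holomorphicFunctions U)[X]} (hf : NoMultipleFactors f) {z₀ : ℂ} (hz₀ : z₀ ∈ U) :
    ∀ᶠ z in 𝓝[≠] z₀, (specializeExtend f z).Separable := by
  have := isDomain_holomorphicFunctions hU hc ⟨z₀, hz₀⟩
  have : CharZero (holomorphicFunctions U) :=
    ⟨fun a b h => by simpa using congrArg (evalAt ⟨z₀, hz₀⟩) h⟩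
  obtain ⟨a, b, d, hd, hab⟩ := exists_bezout_derivative_of_squarefree hf
  filter_upwards [eventually_zeroExtend_ne_zero hU hc hd hz₀,
    mem_nhdsWithin_of_mem_nhds (hU.mem_nhds hz₀)] with z hz hzU
  rw [zeroExtend_of_mem d hzU] at hz
  rw [specializeExtend_of_mem f hzU, specializeAt]
  set e := evalAt (⟨z, hzU⟩ : U)
  have h := congrArg (Polynomial.map e) hab
  simp only [Polynomial.map_add, Polynomial.map_mul, map_C] at h
  refine ⟨C (e d)⁻¹ * a.map e, C (e d)⁻¹ * b.map e, ?_⟩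
  rw [derivative_map, mul_assoc, mul_assoc, ← mul_add, h, ← C_mul, inv_mul_cancel₀ hz, C_1]

theorem ne_zero_of_noMultipleFactors {f : (holomorphicFunctions U)[X]} (hf : NoMultipleFactors f)
    (hU : IsOpen U) (hc : IsPreconnected U) (hne : U.Nonempty) : f ≠ 0 := by
  have := isDomain_holomorphicFunctions hU hc hne
  rintro rfl
  have := Squarefree.ne_zero hf
  simp at this

/-- Near a given point, the polynomials `f(z, ·)` form an unramified family. -/
theorem exists_isUnramifiedFamily (hU : IsOpen U) (hc : IsPreconnected U)
    {f : (holomorphicFunctions U)[X]} (hf : NoMultipleFactors f) {z₀ : ℂ} (hz₀ : z₀ ∈ U) :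
    ∃ δ > 0, Metric.ball z₀ δ ⊆ U ∧
      IsUnramifiedFamily (Metric.ball z₀ δ \ {z₀}) f.natDegree (specializeExtend f) := by
  have h1 := eventually_separable_specializeExtend hU hc hf hz₀
  have h2 := eventually_zeroExtend_ne_zero hU hc
    (leadingCoeff_ne_zero.2 (ne_zero_of_noMultipleFactors hf hU hc ⟨z₀, hz₀⟩)) hz₀
  have h3 := eventually_nhdsWithin_iff.1 (h1.and h2)
  obtain ⟨δ, hδ, h⟩ := Metric.eventually_nhds_iff_ball.1
    (h3.and (hU.mem_nhds hz₀ : ∀ᶠ z in 𝓝 z₀, z ∈ U))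
  refine ⟨δ, hδ, fun z hz => (h z hz).2, fun j => ?_, fun z hz => ?_, fun z hz => ?_⟩
  · simp only [coeff_specializeExtend]
    exact (differentiableOn_zeroExtend _).mono fun z hz => (h z hz.1).2
  · refine le_antisymm ?_ (le_natDegree_of_ne_zero ?_)
    · rw [specializeExtend_of_mem f (h z hz.1).2]
      exact natDegree_map_le
    · rw [coeff_specializeExtend]
      exact ((h z hz.1).1 hz.2).2
  · exact ((h z hz.1).1 hz.2).1

end Specialize

/-! ### Puiseux's theorem -/

/-- A function that is holomorphic and bounded near a point is meromorphic there. -/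
theorem meromorphicAt_zero_of_eventually_norm_le {g : ℂ → ℂ} {C : ℝ}
    (hd : ∀ᶠ t in 𝓝[≠] 0, DifferentiableAt ℂ g t) (hb : ∀ᶠ t in 𝓝[≠] 0, ‖g t‖ ≤ C) :
    MeromorphicAt g 0 := by
  -- Boundedness makes z·g(z) tend to 0, so it extends continuously whatever the value g 0.
  refine ⟨1, ?_⟩
  refine Complex.analyticAt_of_differentiable_on_punctured_nhds_of_continuousAt ?_ ?_
  · filter_upwards [hd] with t ht
    exact (by fun_prop : DifferentiableAt ℂ (fun z : ℂ => (z - 0) ^ 1) t).smul ht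
  · rw [continuousAt_iff_punctured_nhds]
    simp only [sub_zero, pow_one, zero_smul]
    refine NormedField.tendsto_zero_smul_of_tendsto_zero_of_bounded
      (tendsto_id.mono_left nhdsWithin_le_nhds) ?_
    exact ⟨C, by simpa using hb⟩

theorem exp_mem_upperHalfDisk {δ : ℝ} {u : ℂ} (h1 : Real.exp u.re < δ) (h2 : 0 < u.im)
    (h3 : u.im < Real.pi) : Complex.exp u ∈ upperHalfDisk δ := by
  refine ⟨by rwa [mem_ball_zero_iff, Complex.norm_exp], ?_⟩
  rw [Complex.exp_im]
  exact mul_pos (Real.exp_pos _) (Real.sin_pos_of_pos_of_lt_pi h2 h3)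

namespace IsUnramifiedFamily

variable {k : ℕ} {p : ℂ → ℂ[X]} {δ : ℝ}

theorem comp_exp (hp : IsUnramifiedFamily (Metric.ball 0 δ \ {0}) k p) :
    IsUnramifiedFamily {u | Real.exp u.re < δ} k (fun u => p (Complex.exp u)) := by
  have hmaps : ∀ u ∈ {u : ℂ | Real.exp u.re < δ}, Complex.exp u ∈ Metric.ball 0 δ \ {0} :=
    fun u hu => ⟨by rwa [mem_ball_zero_iff, Complex.norm_exp], Complex.exp_ne_zero u⟩
  exact ⟨fun j => (hp.coeff j).comp Complex.differentiable_exp.differentiableOn hmaps,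
    fun u hu => hp.natDegree_eq _ (hmaps u hu), fun u hu => hp.separable _ (hmaps u hu)⟩

theorem isOpen_setOf_exp_re_lt : IsOpen {u : ℂ | Real.exp u.re < δ} :=
  isOpen_lt (by fun_prop) continuous_const

theorem convex_setOf_exp_re_lt (hδ : 0 < δ) : Convex ℝ {u : ℂ | Real.exp u.re < δ} := by
  have : {u : ℂ | Real.exp u.re < δ} = {u | u.re < Real.log δ} := by
    ext u
    exact (Real.lt_log_iff_exp_lt hδ).symm
  rw [this]
  exact convex_halfSpace_re_lt _

/-- In the logarithmic coordinate, a root over the upper half disk continues to a half-plane and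
becomes periodic. -/
theorem exists_periodic_root (hp : IsUnramifiedFamily (Metric.ball 0 δ \ {0}) k p) (hδ : 0 < δ)
    {α : ℂ → ℂ} (hα : ContinuousOn α (upperHalfDisk δ))
    (hα0 : ∀ z ∈ upperHalfDisk δ, (p z).eval (α z) = 0) :
    ∃ (a : ℂ → ℂ) (N : ℕ), N ≠ 0 ∧ DifferentiableOn ℂ a {u | Real.exp u.re < δ} ∧
      (∀ u, Real.exp u.re < δ → (p (Complex.exp u)).eval (a u) = 0) ∧
      (∀ u, Real.exp u.re < δ → a (u + N * (2 * Real.pi * Complex.I)) = a u) ∧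
      ∀ u, Real.exp u.re < δ → 0 < u.im → u.im < Real.pi → a u = α (Complex.exp u) := by
  have hq := hp.comp_exp
  set L : Set ℂ := {u | Real.exp u.re < δ} with hL
  have hLo : IsOpen L := isOpen_setOf_exp_re_lt
  have hLc : Convex ℝ L := convex_setOf_exp_re_lt hδ
  set S : Set ℂ := L ∩ ({u | 0 < u.im} ∩ {u | u.im < Real.pi}) with hS
  have hSc : Convex ℝ S :=
    hLc.inter ((convex_halfSpace_im_gt _).inter (convex_halfSpace_im_lt _))
  set u₀ : ℂ := ⟨Real.log δ - 1, Real.pi / 2⟩ with hu₀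
  have hu₀L : u₀ ∈ L := (Real.lt_log_iff_exp_lt hδ).1 (by simp [hu₀])
  have hu₀S : u₀ ∈ S := ⟨hu₀L, by simp [hu₀, Real.pi_pos], by
    simp only [hu₀, Set.mem_ofPred_eq]; linarith [Real.pi_pos]⟩
  have hexpS : ∀ u ∈ S, Complex.exp u ∈ upperHalfDisk δ := fun u hu =>
    exp_mem_upperHalfDisk hu.1 hu.2.1 hu.2.2
  obtain ⟨a, ha0, hac, har⟩ := hq.exists_root hLo hLc hu₀L (hα0 _ (hexpS _ hu₀S))
  have hshiftL : ∀ (c : ℝ) (u : ℂ), u + c * (2 * Real.pi * Complex.I) ∈ L ↔ u ∈ L := by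
    intro c u
    simp [hL]
  have hexp : ∀ (n : ℕ) (u : ℂ), Complex.exp (u + n * (2 * Real.pi * Complex.I))
      = Complex.exp u := fun n u => Complex.exp_periodic.nat_mul n u
  have hbL : ∀ (n : ℕ), ∀ u ∈ L, u + n * (2 * Real.pi * Complex.I) ∈ L := fun n u hu => by
    simpa using (hshiftL n u).2 hu
  have hbr : ∀ (n : ℕ), ∀ u ∈ L,
      (p (Complex.exp u)).eval (a (u + n * (2 * Real.pi * Complex.I))) = 0 := fun n u hu => by
    have := har _ (hbL n u hu)
    rwa [hexp] at this
  -- Pigeonhole: the values at the translates of u₀ are all roots of one polynomial, so two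
  -- coincide. Uniqueness of lifts then makes n' − n a period.
  obtain ⟨n, n', hlt, heq⟩ := Set.Finite.exists_lt_map_eq_of_forall_mem
    (f := fun n : ℕ => a (u₀ + n * (2 * Real.pi * Complex.I)))
    (t := ((p (Complex.exp u₀)).roots.toFinset : Set ℂ)) (fun n => by
      simpa [(hq.separable u₀ hu₀L).ne_zero] using hbr n u₀ hu₀L) (Finset.finite_toSet _)
  have hbc : ∀ n : ℕ, ContinuousOn (fun u => a (u + n * (2 * Real.pi * Complex.I))) L := fun n =>
    hac.comp (by fun_prop) (hbL n)
  have hE := hq.root_eqOn hLo subset_rfl hLc.isPreconnected (hbc n) (hbc n') (hbr n) (hbr n')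
    hu₀L heq
  refine ⟨a, n' - n, by omega, hq.differentiableOn_root hLo hac har, har, fun u hu => ?_,
    fun u h1 h2 h3 => ?_⟩
  · have hu' : u + (-(n : ℝ) : ℝ) * (2 * Real.pi * Complex.I) ∈ L := (hshiftL _ u).2 hu
    have := hE hu'
    simp only at this
    rw [Nat.cast_sub hlt.le]
    convert this.symm using 2
    · push_cast; ring
    · push_cast; ring
  · exact hq.root_eqOn hLo Set.inter_subset_left hSc.isPreconnected (hac.mono Set.inter_subset_left)
      (hα.comp Complex.continuous_exp.continuousOn hexpS) (fun u hu => har u hu.1)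
      (fun u hu => hα0 _ (hexpS u hu)) hu₀S ha0 ⟨h1, h2, h3⟩

/-- Puiseux's theorem, for a root over the upper half disk: it is a meromorphic function
of `z ^ (1 / N)` near the origin. -/
theorem exists_puiseux (hp : IsUnramifiedFamily (Metric.ball 0 δ \ {0}) k p) (hδ : 0 < δ)
    (hcoeff : ∀ j, AnalyticAt ℂ (fun z => (p z).coeff j) 0)
    {α : ℂ → ℂ} (hα : ContinuousOn α (upperHalfDisk δ))
    (hα0 : ∀ z ∈ upperHalfDisk δ, (p z).eval (α z) = 0) :
    ∃ N₀ : ℕ, N₀ ≠ 0 ∧ ∀ N : ℕ, N ≠ 0 → N₀ ∣ N → ∃ b : ℂ → ℂ, MeromorphicAt b 0 ∧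
      ∀ᶠ t in 𝓝[≠] 0, 0 < t.arg → N * t.arg < Real.pi → b t = α (t ^ N) := by
  obtain ⟨a, N₀, hN₀, had, har, hper, haα⟩ := hp.exists_periodic_root hδ hα hα0
  refine ⟨N₀, hN₀, fun N hN hdvd => ?_⟩
  set L : Set ℂ := {u | Real.exp u.re < δ} with hL
  have hLo : IsOpen L := isOpen_setOf_exp_re_lt
  have hexp : ∀ t : ℂ, t ≠ 0 → Complex.exp (N * Complex.log t) = t ^ N := fun t ht => by
    rw [Complex.exp_nat_mul, Complex.exp_log ht]
  have hpow : Tendsto (fun t : ℂ => t ^ N) (𝓝[≠] 0) (𝓝[≠] 0) := by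
    rw [tendsto_nhdsWithin_iff]
    refine ⟨((continuous_pow N).tendsto' 0 0 (zero_pow hN)).mono_left nhdsWithin_le_nhds, ?_⟩
    filter_upwards [self_mem_nhdsWithin] with t ht using pow_ne_zero N ht
  have hlog : ∀ᶠ t in 𝓝[≠] (0 : ℂ), t ≠ 0 ∧ N * Complex.log t ∈ L := by
    filter_upwards [self_mem_nhdsWithin, (hpow.mono_right nhdsWithin_le_nhds).eventually
      (Metric.ball_mem_nhds 0 hδ)] with t ht htδ
    refine ⟨ht, ?_⟩
    rwa [hL, Set.mem_ofPred_eq, ← Complex.norm_exp, hexp t ht, ← mem_ball_zero_iff]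
  have hperZ : ∀ (n : ℕ), ∀ u ∈ L, a (u + (n * N) * (2 * Real.pi * Complex.I)) = a u := by
    obtain ⟨r, rfl⟩ := hdvd
    have : ∀ (m : ℕ), ∀ u ∈ L, a (u + (m * N₀) * (2 * Real.pi * Complex.I)) = a u := by
      intro m
      induction m with
      | zero => simp
      | succ m ih =>
        intro u hu
        have h1 : u + m * N₀ * (2 * Real.pi * Complex.I) ∈ L := by
          simpa [hL] using hu
        rw [← ih u hu, ← hper _ h1]
        congr 1
        push_cast; ring
    intro n u hu
    rw [← this (n * r) u hu]
    congr 1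
    push_cast; ring
  have hperZ' : ∀ (n : ℤ), ∀ u ∈ L, a (u + (n * N) * (2 * Real.pi * Complex.I)) = a u := by
    intro n u hu
    obtain ⟨m, rfl | rfl⟩ := n.eq_nat_or_neg
    · simpa using hperZ m u hu
    · have h1 : u + (((-(m : ℤ) : ℤ) : ℂ) * N) * (2 * Real.pi * Complex.I) ∈ L := by
        simpa [hL] using hu
      rw [← hperZ m _ h1]
      congr 1
      push_cast; ring
  set b : ℂ → ℂ := fun t => a (N * Complex.log t) with hb
  have hbd : ∀ᶠ t in 𝓝[≠] (0 : ℂ), DifferentiableAt ℂ b t := by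
    filter_upwards [hlog] with t₀ ⟨ht₀, ht₀L⟩
    -- A branch of N·log t holomorphic near t₀ even on the cut; it differs from the principal one by
    -- a multiple of 2πiN, which the periodicity of a absorbs.
    set l : ℂ → ℂ := fun t => N * (Complex.log (t / t₀) + Complex.log t₀) with hl
    have hlt₀ : l t₀ = N * Complex.log t₀ := by simp [hl, div_self ht₀]
    have hld : DifferentiableAt ℂ l t₀ := by
      refine DifferentiableAt.const_mul (DifferentiableAt.add_const _ ?_) _
      refine (differentiableAt_id.div_const t₀).clog ?_
      simp [div_self ht₀]
    have hal : DifferentiableAt ℂ (fun t => a (l t)) t₀ :=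
      DifferentiableAt.comp t₀ (had.differentiableAt (by rw [hlt₀]; exact hLo.mem_nhds ht₀L)) hld
    refine hal.congr_of_eventuallyEq ?_
    filter_upwards [eventually_ne_nhds ht₀,
      hld.continuousAt.eventually_mem (by rw [hlt₀]; exact hLo.mem_nhds ht₀L)] with t ht htL
    have he : Complex.exp (Complex.log t)
        = Complex.exp (Complex.log (t / t₀) + Complex.log t₀) := by
      rw [Complex.exp_log ht, Complex.exp_add, Complex.exp_log (div_ne_zero ht ht₀),
        Complex.exp_log ht₀, div_mul_cancel₀ _ ht₀]
    obtain ⟨n, hn⟩ := Complex.exp_eq_exp_iff_exists_int.1 he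
    rw [hb, ← hperZ' n _ htL]
    simp only [hl, hn]
    congr 1
    ring
  have hbr : ∀ᶠ t in 𝓝[≠] (0 : ℂ), (p (t ^ N)).eval (b t) = 0 := by
    filter_upwards [hlog] with t ⟨ht, htL⟩
    rw [← hexp t ht]
    exact har _ htL
  have hcoeff' : ∀ j, AnalyticAt ℂ (fun t => (p (t ^ N)).coeff j) 0 := fun j => by
    refine AnalyticAt.fun_comp (g := fun z => (p z).coeff j) ?_ (analyticAt_id.pow N)
    simpa [zero_pow hN] using hcoeff j
  have hpow' : ∀ᶠ t in 𝓝[≠] (0 : ℂ), t ^ N ∈ Metric.ball (0 : ℂ) δ \ {0} :=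
    hpow.eventually (sdiff_mem_nhdsWithin_compl (Metric.ball_mem_nhds 0 hδ) {0})
  refine ⟨b, ?_, ?_⟩
  · have hcont : ContinuousAt (fun t => ∑ j ∈ Finset.range (k + 1), ‖(p (t ^ N)).coeff j‖) 0 :=
      tendsto_finsetSum _ fun j _ => (hcoeff' j).continuousAt.norm
    obtain ⟨C, hC⟩ : ∃ C, ∀ᶠ t in 𝓝 0, ∑ j ∈ Finset.range (k + 1), ‖(p (t ^ N)).coeff j‖ ≤ C :=
      ⟨_, hcont.eventually_le_const (lt_add_one _)⟩
    -- The root itself may be unbounded; its product with the leading coefficient is not.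
    have hmer : MeromorphicAt (fun t => (p (t ^ N)).coeff k * b t) 0 := by
      refine meromorphicAt_zero_of_eventually_norm_le (C := C) ?_ ?_
      · filter_upwards [hbd, (hcoeff' k).eventually_analyticAt.filter_mono nhdsWithin_le_nhds]
          with t h1 h2 using h2.differentiableAt.mul h1
      · filter_upwards [hbr, hpow', hC.filter_mono nhdsWithin_le_nhds] with t h1 h2 h3
        have := (p (t ^ N)).norm_leadingCoeff_mul_root_le h1
        rw [leadingCoeff, hp.natDegree_eq _ h2] at this
        exact this.trans h3
    refine (hmer.div (hcoeff' k).meromorphicAt).congr ?_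
    filter_upwards [hpow'] with t ht
    exact mul_div_cancel_left₀ _ (hp.coeff_ne_zero ht)
  · filter_upwards [hlog] with t ⟨ht, htL⟩ h1 h2
    rw [← hexp t ht]
    refine haα _ htL ?_ ?_
    · have : 0 < (N : ℝ) := Nat.cast_pos.2 (Nat.pos_of_ne_zero hN)
      simpa [Complex.log_im] using mul_pos this h1
    · simpa [Complex.log_im] using h2

end IsUnramifiedFamily

/-! ### The sector lying over the upper half-plane -/

section Sector

/-- The open sector `0 < arg t < π / N`. -/
def sector (N : ℕ) : Set ℂ := {t | 0 < t.arg ∧ N * t.arg < Real.pi}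

/-- For N ≥ 2 the opening is at most π/2, so the sector is an intersection of two half-planes.
Unlike conditions on arg, these are sign conditions to which analyticity applies. -/
theorem mem_sector_iff {N : ℕ} (hN : 2 ≤ N) {t : ℂ} (ht : t ≠ 0) :
    t ∈ sector N ↔ 0 < t.im ∧ (t * Complex.exp (-(Real.pi / N : ℝ) * Complex.I)).im < 0 := by
  have hnorm : 0 < ‖t‖ := norm_pos_iff.2 ht
  have hN0 : (0 : ℝ) < N := Nat.cast_pos.2 (by omega)
  have hN2 : (2 : ℝ) ≤ N := by exact_mod_cast hN
  have hq : 0 < Real.pi / N := div_pos Real.pi_pos hN0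
  have hq2 : Real.pi / N ≤ Real.pi / 2 := div_le_div_of_nonneg_left Real.pi_pos.le two_pos hN2
  have h1 : t.im = ‖t‖ * Real.sin t.arg := (Complex.norm_mul_sin_arg t).symm
  have h2 : (t * Complex.exp (-(Real.pi / N : ℝ) * Complex.I)).im
      = ‖t‖ * Real.sin (t.arg - Real.pi / N) := by
    conv_lhs => rw [← Complex.norm_mul_exp_arg_mul_I t, mul_assoc, ← Complex.exp_add, ← add_mul,
      Complex.im_ofReal_mul, ← sub_eq_add_neg, ← Complex.ofReal_sub, Complex.exp_ofReal_mul_I_im]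
  have h3 : t ∈ sector N ↔ 0 < t.arg ∧ t.arg < Real.pi / N := by
    rw [lt_div_iff₀' hN0]; rfl
  rw [h3, h1, h2, mul_pos_iff_of_pos_left hnorm, ← neg_pos, ← mul_neg,
    mul_pos_iff_of_pos_left hnorm, neg_pos]
  have hpi := Complex.arg_le_pi t
  have hpi' := Complex.neg_pi_lt_arg t
  have hpp := Real.pi_pos
  constructor
  · rintro ⟨h4, h5⟩
    exact ⟨Real.sin_pos_of_pos_of_lt_pi h4 (by linarith),
      Real.sin_neg_of_neg_of_neg_pi_lt (by linarith) (by linarith)⟩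
  · rintro ⟨h4, h5⟩
    constructor
    · by_contra! hcon
      linarith [Real.sin_nonpos_of_nonpos_of_neg_pi_le hcon hpi'.le]
    · by_contra! hcon
      linarith [Real.sin_nonneg_of_nonneg_of_le_pi (x := t.arg - Real.pi / N) (by linarith)
        (by linarith)]

theorem eventually_mem_sector_or {N : ℕ} (hN : 2 ≤ N) {τ : ℂ → ℂ} (hτ : AnalyticAt ℂ τ 0)
    (hne : ∀ᶠ s : ℝ in 𝓝[>] 0, τ s ≠ 0) :
    (∀ᶠ s : ℝ in 𝓝[>] 0, τ s ∈ sector N) ∨ ∀ᶠ s : ℝ in 𝓝[>] 0, τ s ∉ sector N := by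
  set e := Complex.exp (-(Real.pi / N : ℝ) * Complex.I)
  -- Rewriting imaginary parts as real parts of analytic functions gives each of the two
  -- inequalities a definite truth value for small s.
  have hre : ∀ z : ℂ, (-Complex.I * z).re = z.im := fun z => by simp
  have h1 := ((analyticAt_const (v := -Complex.I)).mul hτ).meromorphicAt.re_eventually_sign
  have h2 := ((analyticAt_const (v := -Complex.I)).mul
    (hτ.mul (analyticAt_const (v := e)))).meromorphicAt.re_eventually_sign
  simp only [Pi.mul_apply, hre] at h1 h2
  have hright : (∀ᶠ s : ℝ in 𝓝[>] 0, ¬ 0 < (τ s).im ∨ ¬ (τ s * e).im < 0) →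
      ∀ᶠ s : ℝ in 𝓝[>] 0, τ s ∉ sector N := fun h => by
    filter_upwards [h, hne] with s hs hs0 hmem
    have := (mem_sector_iff hN hs0).1 hmem
    tauto
  rcases h1 with h1 | h1 | h1
  · rcases h2 with h2 | h2 | h2
    · exact Or.inr (hright (h2.mono fun s hs => Or.inr hs.le.not_gt))
    · exact Or.inr (hright (h2.mono fun s hs => Or.inr hs.ge.not_gt))
    · left
      filter_upwards [h1, h2, hne] with s hs1 hs2 hs0
      exact (mem_sector_iff hN hs0).2 ⟨hs1, hs2⟩
  · exact Or.inr (hright (h1.mono fun s hs => Or.inl hs.le.not_gt))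
  · exact Or.inr (hright (h1.mono fun s hs => Or.inl hs.le.not_gt))

theorem exists_mem_sector_pow_eq {N : ℕ} (hN : N ≠ 0) {z : ℂ} (hz : 0 < z.im) :
    ∃ t ∈ sector N, t ≠ 0 ∧ t ^ N = z := by
  have hz0 : z ≠ 0 := by rintro rfl; simp at hz
  have hN0 : (0 : ℝ) < N := Nat.cast_pos.2 (Nat.pos_of_ne_zero hN)
  have hN1 : (1 : ℝ) ≤ N := by exact_mod_cast Nat.one_le_iff_ne_zero.2 hN
  have harg0 : 0 < z.arg := by
    refine lt_of_le_of_ne (Complex.arg_nonneg_iff.2 hz.le) fun h => ?_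
    rw [← Complex.norm_mul_sin_arg, ← h] at hz
    simp at hz
  have harg1 : z.arg < Real.pi := by
    refine lt_of_le_of_ne (Complex.arg_le_pi z) fun h => ?_
    rw [← Complex.norm_mul_sin_arg, h] at hz
    simp at hz
  have him : (Complex.log z / N).im = z.arg / N := by
    rw [Complex.div_natCast_im, Complex.log_im]
  have hle : z.arg / N ≤ z.arg := div_le_self harg0.le hN1
  have harg : (Complex.exp (Complex.log z / N)).arg = z.arg / N := by
    rw [← Complex.log_im, Complex.log_exp, him]
    · rw [him]; linarith [div_pos harg0 hN0, Real.pi_pos]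
    · rw [him]; linarith
  refine ⟨Complex.exp (Complex.log z / N), ⟨?_, ?_⟩, Complex.exp_ne_zero _, ?_⟩
  · rw [harg]; exact div_pos harg0 hN0
  · rw [harg, mul_div_cancel₀ _ hN0.ne']; exact harg1
  · rw [← Complex.exp_nat_mul, mul_div_cancel₀ _ (Nat.cast_ne_zero.2 hN), Complex.exp_log hz0]

theorem eventually_im_pos_of_eventually_sector {N : ℕ} (hN : N ≠ 0) {P : ℂ → Prop}
    (h : ∀ᶠ t in 𝓝[≠] 0, t ∈ sector N → P (t ^ N)) : ∀ᶠ z in 𝓝 (0 : ℂ), 0 < z.im → P z := by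
  obtain ⟨ε, hε, hball⟩ := Metric.eventually_nhds_iff_ball.1 (eventually_nhdsWithin_iff.1 h)
  filter_upwards [Metric.ball_mem_nhds 0 (pow_pos hε N)] with z hz hzim
  obtain ⟨t, htS, ht0, rfl⟩ := exists_mem_sector_pow_eq hN hzim
  refine hball t ?_ ht0 htS
  rw [mem_ball_zero_iff, norm_pow] at hz
  exact mem_ball_zero_iff.2 (lt_of_pow_lt_pow_left₀ N hε.le hz)

theorem im_pow_pos_of_mem_sector {N : ℕ} (hN : N ≠ 0) {t : ℂ} (ht : t ≠ 0) (h : t ∈ sector N) :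
    0 < (t ^ N).im := by
  have hN : 0 < (N : ℝ) := Nat.cast_pos.2 (Nat.pos_of_ne_zero hN)
  rw [← Complex.norm_mul_exp_arg_mul_I t, mul_pow, ← Complex.exp_nat_mul, ← Complex.ofReal_pow,
    Complex.im_ofReal_mul, ← mul_assoc, ← Complex.ofReal_natCast, ← Complex.ofReal_mul,
    Complex.exp_ofReal_mul_I_im]
  exact mul_pos (pow_pos (norm_pos_iff.2 ht) N)
    (Real.sin_pos_of_pos_of_lt_pi (mul_pos hN h.1) h.2)

end Sector

/-! ### Gradients and tangential derivatives of real parts -/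

section Gradient

variable {A B : ℂ → ℂ} {α β z : ℂ}

theorem HasDerivAt.hasFDerivAt_re (h : HasDerivAt A α z) :
    HasFDerivAt (fun z => (A z).re) (innerSL ℝ (starRingEnd ℂ α)) z := by
  have h1 : HasFDerivAt A _ z := h.hasFDerivAt.restrictScalars ℝ
  refine (Complex.reCLM.hasFDerivAt.comp z h1).congr_fderiv ?_
  refine ContinuousLinearMap.ext fun v => ?_
  rw [innerSL_apply_apply, Complex.inner, Complex.conj_conj]
  simp [mul_comm]

theorem HasDerivAt.gradient_re (h : HasDerivAt A α z) :
    gradient (fun z => (A z).re) z = starRingEnd ℂ α :=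
  HasGradientAt.gradient h.hasFDerivAt_re

theorem tangentialDeriv_re (hB : HasDerivAt B β z) (hA : HasDerivAt A α z) :
    tangentialDeriv (fun z => (B z).re) (fun z => (A z).re) z
      = (α * (Complex.I * starRingEnd ℂ β / (‖β‖ : ℂ))).re := by
  rw [tangentialDeriv, hA.hasFDerivAt_re.fderiv, unitTangent, hB.gradient_re, RCLike.norm_conj,
    innerSL_apply_apply, Complex.inner, Complex.conj_conj, mul_comm]

/-- Since conj(β) = |β|²/β, the product equals |β|·i·(α/β). -/
theorem re_mul_unitTangent_eq_zero_iff (hβ : β ≠ 0) :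
    (α * (Complex.I * starRingEnd ℂ β / (‖β‖ : ℂ))).re = 0 ↔ (α / β).im = 0 := by
  have hn : (‖β‖ : ℂ) ≠ 0 := Complex.ofReal_ne_zero.2 (norm_ne_zero_iff.2 hβ)
  have h : α * (Complex.I * starRingEnd ℂ β / (‖β‖ : ℂ)) = (‖β‖ : ℂ) * (α / β * Complex.I) := by
    field_simp
    rw [mul_assoc, Complex.conj_mul']
  rw [h, Complex.re_ofReal_mul, Complex.mul_I_re]
  simp [hβ]

end Gradient

/-! ### Half-branches against level curves, and the conclusion -/

/-- Along an analytic half-branch of the set where `φ` is real, the points lying on a level curve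
of `re B` near the origin are not isolated zeros of `im φ` on that level curve. -/
theorem eventually_frequently_on_branch {N : ℕ} (hN : 2 ≤ N) {R c : ℝ} {B β φ b : ℂ → ℂ}
    (hB : ∀ z ∈ upperHalfDisk R, HasDerivAt B (β z) z)
    (hb : MeromorphicAt b 0)
    (hbβ : ∀ᶠ t in 𝓝[≠] 0, t ∈ sector N →
      t ^ N ∈ upperHalfDisk R ∧ β (t ^ N) ≠ 0 ∧ b t = β (t ^ N))
    {τ : ℂ → ℂ} (hτ : AnalyticAt ℂ τ 0) (hτ0 : τ 0 = 0) (hτ' : deriv τ 0 ≠ 0) {ζ : ℂ} (hζ : ζ ≠ 0)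
    (hφ : ∀ᶠ s : ℝ in 𝓝[>] 0, τ (s * ζ) ∈ sector N → (φ (τ (s * ζ) ^ N)).im = 0) :
    ∀ᶠ s : ℝ in 𝓝[>] 0, τ (s * ζ) ∈ sector N → (B (τ (s * ζ) ^ N)).re = c →
      ∃ᶠ z in 𝓝[{z | z ∈ upperHalfDisk R ∧ (B z).re = c ∧ β z ≠ 0} \ {τ (s * ζ) ^ N}]
        (τ (s * ζ) ^ N), (φ z).im = 0 := by
  set M : Set ℂ := {z | z ∈ upperHalfDisk R ∧ (B z).re = c ∧ β z ≠ 0} with hM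
  have htend := IsBranchSystem.tendsto hτ hτ0 hτ' hζ
  have hlin : AnalyticAt ℂ (fun w : ℂ => w * ζ) 0 := analyticAt_id.mul analyticAt_const
  have hτζ : AnalyticAt ℂ (fun w => τ (w * ζ)) 0 :=
    AnalyticAt.fun_comp (g := τ) (by simpa using hτ) hlin
  have hne : ∀ᶠ s : ℝ in 𝓝[>] 0, τ (s * ζ) ≠ 0 := htend.eventually eventually_mem_nhdsWithin
  rcases eventually_mem_sector_or hN hτζ hne with hS | hS
  swap
  · filter_upwards [hS] with s hs h using (hs h).elim
  -- This is the derivative of the branch z = τ(wζ)^N, so Re(b·d) is the derivative of Re B along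
  -- it.
  set d : ℂ → ℂ := fun w => N * τ (w * ζ) ^ (N - 1) * (deriv τ (w * ζ) * ζ) with hd
  have hderivτ : AnalyticAt ℂ (fun w => deriv τ (w * ζ)) 0 :=
    AnalyticAt.fun_comp (g := deriv τ) (by simpa using hτ.deriv) hlin
  have hda : AnalyticAt ℂ d 0 :=
    (analyticAt_const.mul (hτζ.pow _)).mul (hderivτ.mul analyticAt_const)
  have hofReal : Tendsto (fun s : ℝ => (s : ℂ)) (𝓝[>] 0) (𝓝 0) :=
    (Complex.continuous_ofReal.tendsto' 0 0 rfl).mono_left nhdsWithin_le_nhds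
  have hzd : ∀ᶠ s : ℝ in 𝓝[>] 0, HasDerivAt (fun w => τ (w * ζ) ^ N) (d s) (s : ℂ) := by
    have h1 : ∀ᶠ w in 𝓝 (0 : ℂ), AnalyticAt ℂ τ (w * ζ) :=
      hlin.continuousAt.eventually (by simpa using hτ.eventually_analyticAt)
    filter_upwards [hofReal.eventually h1] with s hs
    have h2 : HasDerivAt (fun w : ℂ => w * ζ) ζ (s : ℂ) := by
      simpa using (hasDerivAt_id (s : ℂ)).mul_const ζ
    exact (HasDerivAt.comp (s : ℂ) hs.differentiableAt.hasDerivAt h2).pow N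
  have hd0 : ∀ᶠ s : ℝ in 𝓝[>] 0, d s ≠ 0 := by
    have h1 : ∀ᶠ w in 𝓝 (0 : ℂ), deriv τ (w * ζ) ≠ 0 :=
      hderivτ.continuousAt.eventually_ne (by simpa using hτ')
    filter_upwards [hne, hofReal.eventually h1] with s h2 h3
    have : (N : ℂ) ≠ 0 := Nat.cast_ne_zero.2 (by omega)
    exact mul_ne_zero (mul_ne_zero this (pow_ne_zero _ h2)) (mul_ne_zero h3 hζ)
  have hmer : MeromorphicAt (fun w => b (τ (w * ζ)) * d w) 0 := by
    refine MeromorphicAt.mul (MeromorphicAt.comp_analyticAt (f := b) ?_ hτζ) hda.meromorphicAt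
    simpa [hτ0] using hb
  have hgood : ∀ᶠ s : ℝ in 𝓝[>] 0, (φ (τ (s * ζ) ^ N)).im = 0 ∧
      τ (s * ζ) ^ N ∈ upperHalfDisk R ∧ β (τ (s * ζ) ^ N) ≠ 0 ∧
      HasDerivAt (fun w => τ (w * ζ) ^ N) (d s) (s : ℂ) ∧ d s ≠ 0 ∧
      HasDerivAt (fun s : ℝ => (B (τ (s * ζ) ^ N)).re) (b (τ (s * ζ)) * d s).re s := by
    filter_upwards [hS, hφ, htend.eventually hbβ, hzd, hd0] with s h1 h2 h3 h4 h5
    obtain ⟨h6, h7, h8⟩ := h3 h1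
    refine ⟨h2 h1, h6, h7, h4, h5, ?_⟩
    rw [h8]
    exact HasDerivAt.real_of_complex (HasDerivAt.comp (s : ℂ) (hB _ h6) h4)
  have hIoo : ∀ {P : ℝ → Prop}, (∀ᶠ s in 𝓝[>] (0 : ℝ), P s) → ∃ r > 0, ∀ s ∈ Set.Ioo 0 r, P s := by
    intro P hP
    obtain ⟨r, hr, h⟩ := mem_nhdsGT_iff_exists_Ioo_subset.1 hP
    exact ⟨r, hr, h⟩
  -- If the level c is reached at s₂, injectivity excludes it for all s < s₂.
  have hinj : ∀ {r : ℝ}, 0 < r → Set.InjOn (fun s : ℝ => (B (τ (s * ζ) ^ N)).re) (Set.Ioo 0 r) →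
      ∀ᶠ s : ℝ in 𝓝[>] 0, (B (τ (s * ζ) ^ N)).re ≠ c := by
    intro r hr hinj
    by_cases hex : ∃ s₂ ∈ Set.Ioo 0 r, (B (τ (s₂ * ζ) ^ N)).re = c
    · obtain ⟨s₂, hs₂, heq⟩ := hex
      filter_upwards [Ioo_mem_nhdsGT hs₂.1] with s hs hsc
      exact hs.2.ne (hinj ⟨hs.1, hs.2.trans hs₂.2⟩ hs₂ (hsc.trans heq.symm))
    · filter_upwards [Ioo_mem_nhdsGT hr] with s hs hsc using hex ⟨s, hs, hsc⟩
  rcases hmer.re_eventually_sign with hsign | hsign | hsign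
  · obtain ⟨r, hr, h⟩ := hIoo (hgood.and hsign)
    have hmono : StrictMonoOn (fun s : ℝ => (B (τ (s * ζ) ^ N)).re) (Set.Ioo 0 r) := by
      refine strictMonoOn_of_deriv_pos (convex_Ioo 0 r)
        (fun s hs => (h s hs).1.2.2.2.2.2.continuousAt.continuousWithinAt) fun s hs => ?_
      rw [interior_Ioo] at hs
      rw [(h s hs).1.2.2.2.2.2.deriv]
      exact (h s hs).2
    filter_upwards [hinj hr hmono.injOn] with s hs _ hsc using (hs hsc).elim
  · obtain ⟨r, hr, h⟩ := hIoo (hgood.and hsign)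
    have hconst : ∀ s ∈ Set.Ioo 0 r, ∀ s' ∈ Set.Ioo 0 r,
        (B (τ (s * ζ) ^ N)).re = (B (τ (s' * ζ) ^ N)).re := by
      intro s hs s' hs'
      refine isOpen_Ioo.is_const_of_deriv_eq_zero (f := fun s : ℝ => (B (τ (s * ζ) ^ N)).re)
        isPreconnected_Ioo
        (fun s hs => (h s hs).1.2.2.2.2.2.differentiableAt.differentiableWithinAt)
        (fun s hs => ?_) hs hs'
      rw [(h s hs).1.2.2.2.2.2.deriv]
      exact (h s hs).2
    filter_upwards [Ioo_mem_nhdsGT hr] with s hs _ hsc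
    have hzs : HasDerivAt (fun x : ℝ => τ (x * ζ) ^ N) (d s) s :=
      (h s hs).1.2.2.2.1.comp_ofReal
    -- The branch stays in the level set and has nonzero velocity d(s), so its nearby points are
    -- distinct from the given one and accumulate at it.
    have hz : Tendsto (fun x : ℝ => τ (x * ζ) ^ N) (𝓝[≠] s) (𝓝[M \ {τ (s * ζ) ^ N}]
        (τ (s * ζ) ^ N)) := by
      rw [tendsto_nhdsWithin_iff]
      refine ⟨hzs.continuousAt.mono_left nhdsWithin_le_nhds, ?_⟩
      filter_upwards [hzs.eventually_ne (h s hs).1.2.2.2.2.1 (c := τ (s * ζ) ^ N),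
        mem_nhdsWithin_of_mem_nhds (isOpen_Ioo.mem_nhds hs)] with x hx hxI
      obtain ⟨-, h2, h3, -⟩ := (h x hxI).1
      exact ⟨⟨h2, (hconst x hxI s hs).trans hsc, h3⟩, hx⟩
    refine hz.frequently (Eventually.frequently ?_)
    filter_upwards [mem_nhdsWithin_of_mem_nhds (isOpen_Ioo.mem_nhds hs)] with x hxI
    exact (h x hxI).1.1
  · obtain ⟨r, hr, h⟩ := hIoo (hgood.and hsign)
    have hanti : StrictAntiOn (fun s : ℝ => (B (τ (s * ζ) ^ N)).re) (Set.Ioo 0 r) := by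
      refine strictAntiOn_of_deriv_neg (convex_Ioo 0 r)
        (fun s hs => (h s hs).1.2.2.2.2.2.continuousAt.continuousWithinAt) fun s hs => ?_
      rw [interior_Ioo] at hs
      rw [(h s hs).1.2.2.2.2.2.deriv]
      exact (h s hs).2
    filter_upwards [hinj hr hanti.injOn] with s hs _ hsc using (hs hsc).elim

theorem mainTheorem11 (R : ℝ) (hR : 0 < R) (k : ℕ)
    (f : (holomorphicFunctions (Metric.ball (0 : ℂ) R))[X])
    (hdeg : f.natDegree = k) (hf : NoMultipleFactors f)
    (α : Fin k → ℂ → ℂ)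
    (hα : ∀ μ, DifferentiableOn ℂ (α μ) (upperHalfDisk R))
    (hfac : ∀ z : Metric.ball (0 : ℂ) R, 0 < (z : ℂ).im →
      specializeAt f z = C (evalAt z f.leadingCoeff) * ∏ μ, (X - C (α μ z)))
    (A : Fin k → ℂ → ℂ)
    (hA : ∀ μ, ∀ z ∈ upperHalfDisk R, HasDerivAt (A μ) (α μ z) z)
    (H : Fin k → ℂ → ℝ) (hH : ∀ μ z, H μ z = (A μ z).re)
    (i ν : Fin k) (hiν : i ≠ ν) (c : ℝ) (m l : Fin k) :
    ∃ δ > 0, ∀ Γ : Set ℂ, IsLevelCurve (upperHalfDisk R) (fun z => H i z - H ν z) c Γ →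
      (∀ z ∈ Γ, tangentialDeriv (fun z => H i z - H ν z) (H m) z
        - tangentialDeriv (fun z => H i z - H ν z) (H l) z = 0) ∨
      (∀ z ∈ Γ ∩ Metric.ball (0 : ℂ) δ, tangentialDeriv (fun z => H i z - H ν z) (H m) z
        - tangentialDeriv (fun z => H i z - H ν z) (H l) z ≠ 0) := by
  subst hdeg
  have hHA : ∀ μ, H μ = fun z => (A μ z).re := fun μ => funext (hH μ)
  have hF : (fun z => H i z - H ν z) = fun z => (A i z - A ν z).re := by
    funext z
    rw [hH, hH, Complex.sub_re]
  rw [hF, hHA m, hHA l]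
  set B : ℂ → ℂ := fun z => A i z - A ν z with hBdef
  set β : ℂ → ℂ := fun z => α i z - α ν z with hβ
  set γ : ℂ → ℂ := fun z => α m z - α l z with hγ
  set φ : ℂ → ℂ := fun z => γ z / β z with hφ
  have hB : ∀ z ∈ upperHalfDisk R, HasDerivAt B (β z) z := fun z hz => (hA i z hz).sub (hA ν z hz)
  have hDo : IsOpen (upperHalfDisk R) :=
    Metric.isOpen_ball.inter (isOpen_lt continuous_const Complex.continuous_im)
  set M : Set ℂ := {z | z ∈ upperHalfDisk R ∧ (B z).re = c ∧ β z ≠ 0} with hM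
  have hMeq : smoothLevelSet (upperHalfDisk R) (fun z => (B z).re) c = M := by
    ext z
    refine and_congr_right fun hz => and_congr_right fun _ => ?_
    rw [(hB z hz).gradient_re, ne_eq, map_eq_zero]
  have hQ : ∀ z ∈ M, tangentialDeriv (fun z => (B z).re) (fun z => (A m z).re) z
      - tangentialDeriv (fun z => (B z).re) (fun z => (A l z).re) z = 0 ↔ (φ z).im = 0 := by
    intro z hz
    rw [tangentialDeriv_re (hB z hz.1) (hA m z hz.1), tangentialDeriv_re (hB z hz.1) (hA l z hz.1),
      ← Complex.sub_re, ← sub_mul]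
    exact re_mul_unitTangent_eq_zero_iff hz.2.2
  have hdich : ∀ p ∈ M, (∀ᶠ z in 𝓝[M] p, (φ z).im = 0) ∨
      ∀ᶠ z in 𝓝[M \ {p}] p, (φ z).im ≠ 0 := by
    intro p hp
    have hBa : AnalyticAt ℂ B p := DifferentiableOn.analyticAt
      (fun z hz => (hB z hz).differentiableAt.differentiableWithinAt) (hDo.mem_nhds hp.1)
    have hαa : ∀ μ, AnalyticAt ℂ (α μ) p := fun μ => (hα μ).analyticAt (hDo.mem_nhds hp.1)
    refine hBa.im_eq_zero_or_ne_zero_on_level (by rw [(hB p hp.1).deriv]; exact hp.2.2)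
      (((hαa m).sub (hαa l)).div ((hαa i).sub (hαa ν)) hp.2.2) (fun z hz => hz.2.1) hp
  have h0 : (0 : ℂ) ∈ Metric.ball (0 : ℂ) R := Metric.mem_ball_self hR
  obtain ⟨δ, hδ, hδR, hfam⟩ := exists_isUnramifiedFamily Metric.isOpen_ball
    (convex_ball (0 : ℂ) R).isPreconnected hf h0
  have hsub : upperHalfDisk δ ⊆ upperHalfDisk R := fun z hz => ⟨hδR hz.1, hz.2⟩
  have hne0 : ∀ {z : ℂ}, 0 < z.im → z ≠ 0 := by
    rintro z hz rfl
    simp at hz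
  have hprod : ∀ z ∈ upperHalfDisk R, ∃ a : ℂ,
      specializeExtend f z = C a * ∏ μ, (X - C (α μ z)) := fun z hz =>
    ⟨_, by rw [specializeExtend_of_mem f hz.1]; exact hfac ⟨z, hz.1⟩ hz.2⟩
  have hroot : ∀ μ, ∀ z ∈ upperHalfDisk δ, (specializeExtend f z).eval (α μ z) = 0 := by
    intro μ z hz
    obtain ⟨a, ha⟩ := hprod z (hsub hz)
    rw [ha, eval_mul, eval_prod, Finset.prod_eq_zero (Finset.mem_univ μ) (by simp), mul_zero]
  have hβ0 : ∀ z ∈ upperHalfDisk δ, β z ≠ 0 := by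
    intro z hz h
    obtain ⟨a, ha⟩ := hprod z (hsub hz)
    have hsep := hfam.separable z ⟨hz.1, hne0 hz.2⟩
    rw [ha] at hsep
    exact hiν ((separable_prod_X_sub_C_iff.1 hsep.of_mul_right) (sub_eq_zero.1 h))
  have hcoeff : ∀ j, AnalyticAt ℂ (fun z => (specializeExtend f z).coeff j) 0 := by
    intro j
    simp only [coeff_specializeExtend]
    exact (differentiableOn_zeroExtend _).analyticAt (Metric.isOpen_ball.mem_nhds h0)
  choose N₀ hN₀ hpuiseux using fun μ => hfam.exists_puiseux hδ hcoeff
    ((hα μ).continuousOn.mono hsub) (hroot μ)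
  -- A common exponent for all the roots; the factor 2 ensures N ≥ 2, as the half-plane description
  -- of the sector requires.
  set N : ℕ := 2 * ∏ μ, N₀ μ with hN
  have hprod0 : ∏ μ, N₀ μ ≠ 0 := Finset.prod_ne_zero_iff.2 fun μ _ => hN₀ μ
  have hN2 : 2 ≤ N := by omega
  choose b hbm hb using fun μ => hpuiseux μ N (by omega)
    (dvd_mul_of_dvd_right (Finset.dvd_prod_of_mem N₀ (Finset.mem_univ μ)) 2)
  have hsector : ∀ᶠ t in 𝓝[≠] (0 : ℂ), t ∈ sector N →
      t ^ N ∈ upperHalfDisk δ ∧ ∀ μ, b μ t = α μ (t ^ N) := by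
    have hpow : Tendsto (fun t : ℂ => t ^ N) (𝓝[≠] 0) (𝓝 0) :=
      ((continuous_pow N).tendsto' 0 0 (zero_pow (by omega))).mono_left nhdsWithin_le_nhds
    filter_upwards [hpow.eventually (Metric.ball_mem_nhds 0 hδ), self_mem_nhdsWithin,
      eventually_all.2 hb] with t h1 h2 h3 h4
    exact ⟨⟨h1, im_pow_pos_of_mem_sector (by omega) h2 h4⟩, fun μ => h3 μ h4.1 h4.2⟩
  set ψ : ℂ → ℂ := fun t => (b m t - b l t) / (b i t - b ν t) with hψ
  have hψm : MeromorphicAt ψ 0 := ((hbm m).sub (hbm l)).div ((hbm i).sub (hbm ν))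
  have hψφ : ∀ᶠ t in 𝓝[≠] (0 : ℂ), t ∈ sector N → ψ t = φ (t ^ N) := by
    filter_upwards [hsector] with t h1 h2
    have h3 := (h1 h2).2
    simp only [hψ, hφ, hγ, hβ, h3]
  have hmain : ∀ᶠ z in 𝓝 (0 : ℂ), 0 < z.im → z ∈ M → (φ z).im = 0 →
      ∀ᶠ w in 𝓝[M] z, (φ w).im = 0 := by
    rcases hψm.exists_isBranchSystem with h | ⟨Z, τ, h⟩
    · have h1 : ∀ᶠ z in 𝓝 (0 : ℂ), 0 < z.im → (φ z).im = 0 := by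
        refine eventually_im_pos_of_eventually_sector (N := N) (by omega) ?_
        filter_upwards [h, hψφ] with t h1 h2 h3
        rw [← h2 h3, h1]
      filter_upwards [eventually_eventually_nhds.2 h1] with z hz _ _ _
      filter_upwards [hz.filter_mono nhdsWithin_le_nhds, self_mem_nhdsWithin] with w h2 h3
      exact h2 h3.1.2
    · have hP := h.of_forall_mem (fun t => t ∈ sector N → (B (t ^ N)).re = c →
        ∃ᶠ z in 𝓝[M \ {t ^ N}] (t ^ N), (φ z).im = 0) (fun ζ hζ => ?_)
      · refine eventually_im_pos_of_eventually_sector (N := N) (by omega) ?_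
        filter_upwards [hP, hψφ] with t h1 h2 h3 h4 h5
        rw [← h2 h3] at h5
        -- Zeros accumulating within the level set rule out the isolated alternative.
        exact (hdich _ h4).resolve_right fun hcon => h1 h5 h3 h4.2.1 hcon
      · refine eventually_frequently_on_branch (b := fun t => b i t - b ν t) hN2 hB
          ((hbm i).sub (hbm ν)) ?_ h.analyticAt h.map_zero h.deriv_ne_zero (h.ne_zero ζ hζ) ?_
        · filter_upwards [hsector] with t h1 h2
          obtain ⟨h3, h4⟩ := h1 h2
          exact ⟨hsub h3, hβ0 _ h3, by rw [h4, h4]⟩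
        · filter_upwards [h.mem ζ hζ, (IsBranchSystem.tendsto h.analyticAt h.map_zero
            h.deriv_ne_zero (h.ne_zero ζ hζ)).eventually hψφ] with s h1 h2 h3
          rw [← h2 h3, h1]
  obtain ⟨ε, hε, hball⟩ := Metric.eventually_nhds_iff_ball.1 hmain
  refine ⟨ε, hε, fun Γ hΓ => ?_⟩
  obtain ⟨p, -, rfl⟩ := hΓ
  rw [hMeq]
  have hΓM := connectedComponentIn_subset M p
  refine or_iff_not_imp_right.2 fun hcon z hz => (hQ z (hΓM hz)).2 ?_
  push Not at hcon
  obtain ⟨q, ⟨hqΓ, hqε⟩, hq⟩ := hcon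
  have hqM := hΓM hqΓ
  exact eq_zero_on_connectedComponentIn hdich hqΓ
    (hball q hqε hqM.1.2 hqM ((hQ q hqM).1 hq)) z hz
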